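/- Let $g$ be a non-constant meromorphic function on $\mathbb{C}$ of zero order, i.e. $\limsup_{r\to\infty}\frac{\log^+T(r,g)}{\log r}=0$, where $T(r,g)=m(r,g)+N(r,g)$ is the Nevanlinna characteristic. Let $q,c\in\mathbb{C}$ with $0<|q|<1$, let $$\mathcal{D}_{q,c}g(z)=\frac{g(qz+c)-g(z)}{(q-1)z+c}$$ be the Hahn difference operator, and let $a_1,\dots,a_l$ ($l\ge 2$) be distinct points of $\mathbb{C}\cup\{\infty\}$. Let $N(r,g=a)$ denote the integrated counting function of the $a$-points of $g$ with multiplicity (of the poles, if $a=\infty$), put $N(r,f)=N(r,f=\infty)$, and set $$N_{q,c}(r)=2N(r,g)-N(r,\mathcal{D}_{q,c}g)+N\Big(r,\frac{1}{\mathcal{D}_{q,c}g}\Big).$$ For $a\in\mathbb{C}\cup\{\infty\}$ let $\hat n_{q,c}(t,g=a)$ be the sum, over all points $z$ with $|z|\le t$ at which $g(z)=a$, of the integers $n-\min\{n,m'\}$, where $n$ is the multiplicity with which $g$ takes the value $a$ at $z$, and $m'\ge 0$ is the multiplicity of $z$ as a zero of $\mathcal{D}_{q,c}g$ if $a\neq\infty$,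 respectively of $\mathcal{D}_{q,c}(1/g)$ if $a=\infty$ (with $m'=0$ if $z$ is not a zero). Let $$\hat N_{q,c}(r,g=a)=\int_0^r\frac{\hat n_{q,c}(t,g=a)-\hat n_{q,c}(0,g=a)}{t}\,dt+\hat n_{q,c}(0,g=a)\log r .$$ Then there is a measurable set $E_1$ of logarithmic density one, i.e. $\frac{1}{\log r}\int_{E_1\cap[1,r]}\frac{dt}{t}\to 1$ as $r\to\infty$, such that for all $r\in E_1$ $$(l-2)\,T(r,g)\le\sum_{i=1}^{l}N(r,g=a_i)-N_{q,c}(r)+o(T(r,g))\le\sum_{i=1}^{l}\hat N_{q,c}(r,g=a_i)+o(T(r,g)),$$ where $o(T(r,g))$ refers to $r\to\infty$ in $E_1$. -/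

import Mathlib

open Filter Topology Asymptotics

noncomputable section

namespace HahnNevanlinna

/-- The Hahn difference operator `D_{q,c} g (z) = (g (q z + c) - g z) / ((q - 1) z + c)`.
Meromorphic functions on the plane are represented by total functions `ℂ → ℂ`; all notions below
depend only on the values of the function away from a closed discrete set of points. -/
def hahnDiff (q c : ℂ) (g : ℂ → ℂ) : ℂ → ℂ :=
  fun z => (g (q * z + c) - g z) / ((q - 1) * z + c)

/-- The meromorphic function `g` is constant: it agrees with a constant function outside a closed
discrete set. -/
def IsConstMeromorphic (g : ℂ → ℂ) : Prop :=
  ∃ b : ℂ, g =ᶠ[codiscrete ℂ] fun _ => b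

/-- The Nevanlinna characteristic `T(r, g) = m(r, g) + N(r, g)`. -/
def nevT (g : ℂ → ℂ) (r : ℝ) : ℝ :=
  ValueDistribution.characteristic g ⊤ r

/-- The integrated counting function `N(r, g)` of the poles of `g`, with multiplicity. -/
def nevN (g : ℂ → ℂ) (r : ℝ) : ℝ :=
  ValueDistribution.logCounting g ⊤ r

/-- The integrated counting function `N(r, g = a)` of the `a`-points of `g`, with multiplicity,
for `a` in the extended plane; the point `⊤` is infinity. -/
def nevNAt (g : ℂ → ℂ) (a : WithTop ℂ) (r : ℝ) : ℝ :=
  ValueDistribution.logCounting g a r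

/-- The order of growth `limsup (log⁺ T(r, g) / log r)` as `r → ∞`, as an extended real. -/
def growthOrder (g : ℂ → ℂ) : EReal :=
  limsup (fun r : ℝ => ((Real.posLog (nevT g r) / Real.log r : ℝ) : EReal)) atTop

/-- The multiplicities `z ↦ n - min n m'` counted by the Hahn type counting function of `g = a`.
Here `n` is the multiplicity of `g = a` at `z` (zero if `z` is not an `a`-point), and `m'` is the
multiplicity of `z` as a zero of `D_{q,c} g` if `a` is finite, and of `D_{q,c} (1 / g)` if
`a = ∞`. -/
def hahnDivisor (q c : ℂ) (g : ℂ → ℂ) : WithTop ℂ → Function.locallyFinsupp ℂ ℤ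
  | ⊤ =>
    (MeromorphicOn.divisor g Set.univ)⁻ -
      (MeromorphicOn.divisor g Set.univ)⁻ ⊓ (MeromorphicOn.divisor (hahnDiff q c g⁻¹) Set.univ)⁺
  | (a : ℂ) =>
    (MeromorphicOn.divisor (fun z => g z - a) Set.univ)⁺ -
      (MeromorphicOn.divisor (fun z => g z - a) Set.univ)⁺ ⊓
        (MeromorphicOn.divisor (hahnDiff q c g) Set.univ)⁺

/-- The Hahn type integrated counting function `N̂_{q,c}(r, g = a)`, that is
`∫₀ʳ (n̂(t) - n̂(0)) / t dt + n̂(0) log r` where `n̂(t)` is the sum over `|z| ≤ t` of the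
multiplicities in `hahnDivisor`. -/
def hahnN (q c : ℂ) (g : ℂ → ℂ) (a : WithTop ℂ) (r : ℝ) : ℝ :=
  Function.locallyFinsuppWithin.logCounting (hahnDivisor q c g a) r

/-- `N_{q,c}(r) = 2 N(r, g) - N(r, D_{q,c} g) + N(r, 1 / D_{q,c} g)`. -/
def hahnRamification (q c : ℂ) (g : ℂ → ℂ) (r : ℝ) : ℝ :=
  2 * nevN g r - nevN (hahnDiff q c g) r + nevN (hahnDiff q c g)⁻¹ r

/-- `E` is a measurable set of logarithmic density one:
`(1 / log r) ∫_{E ∩ [1, r]} dt / t → 1` as `r → ∞`. -/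
def HasLogDensityOne (E : Set ℝ) : Prop :=
  MeasurableSet E ∧
    Tendsto (fun r : ℝ => (∫ t in E ∩ Set.Icc 1 r, t⁻¹) / Real.log r) atTop (𝓝 1)

end HahnNevanlinna

end

/-! ### Sets of logarithmic density zero and one. -/

namespace HahnNevanlinna

open MeasureTheory Set

/-! The argument is Nevanlinna's proof of the second main theorem with D = D_{q,c} g in place of g'.
The lemma on the logarithmic derivative is replaced by `proximity_shift_quotient_le_characteristic`:
m(r, f(qz+c)/f) is at most A / log K times the sum of the characteristics of f and 1/f at radius
K²r, where A depends only on q and c and K ≥ 4 is free. To see this, split log |f| on |z| ≤ Kr into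
logarithms at the zeros and poles and a harmonic remainder. Replacing z by qz+c changes each
logarithm by O(1) in circle mean, uniformly in the position of the zero or pole, and their number is
at most the counting functions at K²r divided by log K. The harmonic part oscillates on |z| ≤ 2r by
O(1/K) times its mean modulus on |z| = Kr.

Zero order means log⁺ T(r) = o(log r). A monotone function of this size can increase by log 2
between r and K²r only on a set of logarithmic density zero (`hasLogDensityZero_of_monotone`), and a
diagonal choice serves K = n + 4 for all n with one set E. One K gives only an error O(T); since K
is arbitrary, the error is o(T) along E.

First inequality (`exists_mul_nevT_le`): a value of g is close to at most one of the finite targets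
b_i, so the m(r, 1/(g-b_i)) add up to at most m(r, 1/D) plus the errors m(r, D/(g-b_i)). The first
main theorem for D and m(r, D) ≤ m(r, g) + m(r, D/g) then produce the ramification term.

Second inequality (`exists_sum_nevNAt_sub_hahnRamification_le`): this is local. At each point the
multiplicity that is discarded is at most the pole order of g, plus that of g(qz+c), plus the order
of D (`valueDivisor_sub_hahnDivisor_le`). Far out the contraction z ↦ qz+c moves points towards the
origin, so the poles of g(qz+c) are counted by at most N(r, g) + O(1). This is where 2N(r, g) comes
from. -/

/-- The logarithmic measure of `S ∩ [1, r]`. -/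
noncomputable def logMass (S : Set ℝ) (r : ℝ) : ℝ := ∫ t in S ∩ Icc 1 r, t⁻¹

/-- `S` is a measurable set of logarithmic density zero. -/
def HasLogDensityZero (S : Set ℝ) : Prop :=
  MeasurableSet S ∧ Tendsto (fun r : ℝ => logMass S r / Real.log r) atTop (𝓝 0)

lemma integrableOn_inv_Icc_one (S : Set ℝ) (r : ℝ) :
    IntegrableOn (fun t : ℝ => t⁻¹) (S ∩ Icc 1 r) := by
  refine IntegrableOn.mono_set ?_ inter_subset_right
  apply ContinuousOn.integrableOn_Icc
  intro x hx
  exact (continuousAt_inv₀ (by linarith [hx.1] : x ≠ 0)).continuousWithinAt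

lemma ae_nonneg_inv_of_measurable {S : Set ℝ} (hS : MeasurableSet S) (r : ℝ) :
    0 ≤ᵐ[volume.restrict (S ∩ Icc 1 r)] fun t : ℝ => t⁻¹ := by
  filter_upwards [ae_restrict_mem (hS.inter measurableSet_Icc)] with t ht
  exact inv_nonneg.2 (by linarith [ht.2.1])

lemma logMass_nonneg {S : Set ℝ} (hS : MeasurableSet S) (r : ℝ) : 0 ≤ logMass S r :=
  integral_nonneg_of_ae (ae_nonneg_inv_of_measurable hS r)

lemma logMass_le_of_inter_subset {S U : Set ℝ} (hU : MeasurableSet U) {r : ℝ}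
    (h : S ∩ Icc 1 r ⊆ U) : logMass S r ≤ logMass U r :=
  setIntegral_mono_set (integrableOn_inv_Icc_one U r) (ae_nonneg_inv_of_measurable hU r)
    (LE.le.eventuallyLE (subset_inter h inter_subset_right))

lemma logMass_union_le {S U : Set ℝ} (hS : MeasurableSet S) (hU : MeasurableSet U) (r : ℝ) :
    logMass (S ∪ U) r ≤ logMass S r + logMass U r := by
  have h : (S ∪ U) ∩ Icc 1 r = (S ∩ Icc 1 r) ∪ ((U \ S) ∩ Icc 1 r) := by
    ext x; simp only [mem_inter_iff, mem_union, Set.mem_sdiff]; tauto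
  have h2 : logMass (S ∪ U) r = logMass S r + logMass (U \ S) r := by
    unfold logMass
    rw [h, setIntegral_union _ ((hU.diff hS).inter measurableSet_Icc)
      (integrableOn_inv_Icc_one S r) (integrableOn_inv_Icc_one (U \ S) r)]
    exact Set.disjoint_left.2 fun x hx hx' => hx'.1.2 hx.1
  rw [h2]
  gcongr
  exact logMass_le_of_inter_subset hU (inter_subset_left.trans sdiff_subset)

lemma logMass_add_compl {S : Set ℝ} (hS : MeasurableSet S) {r : ℝ} (hr : 1 ≤ r) :
    logMass S r + logMass Sᶜ r = Real.log r := by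
  have h := setIntegral_union (μ := volume) (f := fun t : ℝ => t⁻¹)
    (s := S ∩ Icc 1 r) (t := Sᶜ ∩ Icc 1 r)
    (Set.disjoint_left.2 fun x hx hx' => hx'.1 hx.1) (hS.compl.inter measurableSet_Icc)
    (integrableOn_inv_Icc_one S r) (integrableOn_inv_Icc_one Sᶜ r)
  unfold logMass
  rw [← h, ← union_inter_distrib_right, union_compl_self, univ_inter, integral_Icc_eq_integral_Ioc,
    ← intervalIntegral.integral_of_le hr, integral_inv_of_pos one_pos (by linarith), div_one]

lemma HasLogDensityZero.compl {S : Set ℝ} (h : HasLogDensityZero S) : HasLogDensityOne Sᶜ := by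
  refine ⟨h.1.compl, ?_⟩
  have h1 : Tendsto (fun r : ℝ => 1 - logMass S r / Real.log r) atTop (𝓝 1) := by
    simpa using h.2.const_sub 1
  refine h1.congr' ?_
  filter_upwards [eventually_gt_atTop 1] with r hr
  have hl := Real.log_pos hr
  have := logMass_add_compl h.1 hr.le
  change _ = logMass Sᶜ r / Real.log r
  rw [eq_div_iff hl.ne', sub_mul, div_mul_cancel₀ _ hl.ne']
  linarith

lemma HasLogDensityZero.union {S U : Set ℝ} (hS : HasLogDensityZero S)
    (hU : HasLogDensityZero U) : HasLogDensityZero (S ∪ U) := by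
  refine ⟨hS.1.union hU.1, ?_⟩
  have h := hS.2.add hU.2
  rw [add_zero] at h
  refine squeeze_zero' ?_ ?_ h
  · filter_upwards [eventually_ge_atTop 1] with r hr
    exact div_nonneg (logMass_nonneg (hS.1.union hU.1) r) (Real.log_nonneg hr)
  · filter_upwards [eventually_ge_atTop 1] with r hr
    rw [← add_div]
    exact div_le_div_of_nonneg_right (logMass_union_le hS.1 hU.1 r) (Real.log_nonneg hr)

lemma HasLogDensityZero.biUnion_le {B : ℕ → Set ℝ} (hB : ∀ n, HasLogDensityZero (B n)) (n : ℕ) :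
    HasLogDensityZero (⋃ m ≤ n, B m) := by
  induction n with
  | zero => simpa using hB 0
  | succ n ih =>
    rw [Set.biUnion_le_succ]
    exact ih.union (hB (n + 1))

/-- Countably many sets of logarithmic density zero are eventually avoided along a single set of
logarithmic density one. -/
theorem exists_logDensityOne_eventually_notMem {B : ℕ → Set ℝ}
    (hB : ∀ n, HasLogDensityZero (B n)) :
    ∃ E, HasLogDensityOne E ∧ ∀ n, ∀ᶠ r in atTop ⊓ 𝓟 E, r ∉ B n := by
  have h1 (n : ℕ) : ∃ R : ℝ, 1 < R ∧ ∀ r ≥ R,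
      logMass (⋃ m ≤ n, B m) r / Real.log r < 1 / ((n : ℝ) + 1) := by
    have h := (HasLogDensityZero.biUnion_le hB n).2.eventually_lt_const
      (show (0 : ℝ) < 1 / ((n : ℝ) + 1) by positivity)
    obtain ⟨R, hR⟩ := eventually_atTop.1 h
    exact ⟨max R 2, by simp, fun r hr => hR r (le_trans (le_max_left _ _) hr)⟩
  choose R hR1 hR using h1
  -- Since every `R k` exceeds 1, the partial sums are thresholds that dominate `R n`, increase, and
  -- tend to infinity.
  set ρ : ℕ → ℝ := fun n => ∑ k ∈ Finset.range (n + 1), R k with hρ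
  have hρR (n : ℕ) : R n ≤ ρ n :=
    Finset.single_le_sum (f := R) (fun k _ => by linarith [hR1 k]) (by simp)
  have hρm : Monotone ρ := monotone_nat_of_le_succ fun n => by
    simp only [hρ]; rw [Finset.sum_range_succ _ (n + 1)]; linarith [hR1 (n + 1)]
  have hρn (n : ℕ) : (n : ℝ) ≤ ρ n := by
    have : ∑ k ∈ Finset.range (n + 1), (1 : ℝ) ≤ ρ n :=
      Finset.sum_le_sum fun k _ => (hR1 k).le
    simp at this; linarith
  -- Diagonal choice: `B m` is removed only beyond `ρ m`, so up to a radius in [ρ n, ρ (n+1)) only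
  -- `B 0`, …, `B n` matter, and their union has relative logarithmic mass below 1/(n+1) there.
  set Bad : Set ℝ := ⋃ m, B m ∩ Ici (ρ m) with hBad
  have hBadm : MeasurableSet Bad :=
    MeasurableSet.iUnion fun m => (hB m).1.inter measurableSet_Ici
  have key (N : ℕ) (r : ℝ) (hr : ρ N ≤ r) : logMass Bad r / Real.log r < 1 / ((N : ℝ) + 1) := by
    classical
    have hex : ∃ n, r < ρ (n + 1) := by
      obtain ⟨n, hn⟩ := exists_nat_gt r
      exact ⟨n, hn.trans_le ((hρn n).trans (hρm n.le_succ))⟩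
    set n := Nat.find hex with hn
    have hn1 : r < ρ (n + 1) := Nat.find_spec hex
    have hNn : N ≤ n := by
      by_contra! hlt
      exact absurd (hρm (Nat.succ_le_of_lt hlt)) (by simp only [Nat.succ_eq_add_one]; linarith)
    have hn2 : ρ n ≤ r := by
      rcases Nat.eq_zero_or_pos n with h0 | hpos
      · have : N = n := by omega
        rwa [← this]
      · have := Nat.find_min hex (m := n - 1) (by omega)
        rw [not_lt] at this
        rwa [Nat.sub_add_cancel hpos] at this
    have hr1 : 1 < r := (hR1 n).trans_le ((hρR n).trans hn2)
    have hsub : Bad ∩ Icc 1 r ⊆ ⋃ m ≤ n, B m := by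
      rintro t ⟨ht, ht1, htr⟩
      obtain ⟨m, hm, hm'⟩ := mem_iUnion.1 ht
      have : m ≤ n := by
        by_contra! hlt
        have h3 := hρm (Nat.succ_le_of_lt hlt)
        have h4 : ρ m ≤ t := hm'
        simp only [Nat.succ_eq_add_one] at h3
        linarith
      exact mem_biUnion (show m ∈ {m | m ≤ n} from this) hm
    calc logMass Bad r / Real.log r ≤ logMass (⋃ m ≤ n, B m) r / Real.log r :=
          div_le_div_of_nonneg_right (logMass_le_of_inter_subset
            (HasLogDensityZero.biUnion_le hB n).1 hsub) (Real.log_nonneg hr1.le)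
      _ < 1 / ((n : ℝ) + 1) := hR n r ((hρR n).trans hn2)
      _ ≤ 1 / ((N : ℝ) + 1) := by
          apply one_div_le_one_div_of_le (by positivity)
          exact_mod_cast Nat.succ_le_succ hNn
  have hzero : HasLogDensityZero Bad := by
    refine ⟨hBadm, ?_⟩
    rw [Metric.tendsto_atTop]
    intro ε hε
    obtain ⟨N, hN⟩ := exists_nat_one_div_lt hε
    refine ⟨max 1 (ρ N), fun r hr => ?_⟩
    have h1r : 1 ≤ r := le_trans (le_max_left _ _) hr
    rw [Real.dist_eq, sub_zero,
      abs_of_nonneg (div_nonneg (logMass_nonneg hBadm r) (Real.log_nonneg h1r))]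
    exact (key N r (le_trans (le_max_right _ _) hr)).trans hN
  refine ⟨Badᶜ, hzero.compl, fun n => ?_⟩
  rw [eventually_inf_principal]
  filter_upwards [eventually_ge_atTop (ρ n)] with r hr hrE hrB
  exact hrE (mem_iUnion.2 ⟨n, hrB, hr⟩)

/-- A monotone function that is `o(log r)` has jumps of size `η` on a fixed logarithmic scale only
on a set of logarithmic density zero. -/
theorem hasLogDensityZero_of_monotone {v : ℝ → ℝ} (hv : Monotone v) (hv0 : ∀ t, 0 ≤ v t)
    (hlog : Tendsto (fun r => v r / Real.log r) atTop (𝓝 0)) {M : ℝ} (hM : 1 ≤ M) {η : ℝ}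
    (hη : 0 < η) : HasLogDensityZero {t | v t + η ≤ v (M * t)} := by
  set B : Set ℝ := {t | v t + η ≤ v (M * t)} with hBdef
  have hvM : Monotone fun t => v (M * t) := fun s t hst =>
    hv (mul_le_mul_of_nonneg_left hst (by linarith))
  have hBm : MeasurableSet B :=
    measurableSet_le (hv.measurable.add_const η) hvM.measurable
  have hM0 : 0 < M := by linarith
  have inv_cont {a b : ℝ} (ha : 0 < a) (hab : a ≤ b) : ContinuousOn (fun t : ℝ => t⁻¹) (uIcc a b) := by
    intro x hx
    rw [uIcc_of_le hab] at hx
    exact (continuousAt_inv₀ (by linarith [hx.1] : x ≠ 0)).continuousWithinAt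
  have hint {u : ℝ → ℝ} (hu : Monotone u) {a b : ℝ} (ha : 0 < a) (hab : a ≤ b) :
      IntervalIntegrable (fun t => u t * t⁻¹) volume a b :=
    hu.intervalIntegrable.mul_continuousOn (inv_cont ha hab)
  -- On `B` one has η ≤ v(Mt) - v(t). Integrating against dt/t and substituting t ↦ Mt telescopes to
  -- the integral over [r, Mr] minus the one over [1, M]; the latter is nonnegative and is dropped.
  have bound (r : ℝ) (hr : 1 ≤ r) : η * logMass B r ≤ Real.log M * v (M * r) := by
    have hr0 : 0 < r := by linarith
    have hrM : r ≤ M * r := le_mul_of_one_le_left hr0.le hM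
    have s1 : η * logMass B r ≤ ∫ t in B ∩ Icc 1 r, (v (M * t) * t⁻¹ - v t * t⁻¹) := by
      unfold logMass
      rw [← integral_const_mul]
      refine setIntegral_mono_on ((integrableOn_inv_Icc_one B r).const_mul η) ?_
        (hBm.inter measurableSet_Icc) ?_
      · refine IntegrableOn.mono_set ?_ (inter_subset_right : _ ⊆ Icc 1 r)
        rw [integrableOn_Icc_iff_integrableOn_Ioc,
          ← intervalIntegrable_iff_integrableOn_Ioc_of_le hr]
        exact (hint hvM one_pos hr).sub (hint hv one_pos hr)
      · rintro t ⟨ht, ht1, -⟩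
        rw [← sub_mul]
        have : v t + η ≤ v (M * t) := ht
        exact mul_le_mul_of_nonneg_right (by linarith) (inv_nonneg.2 (by linarith))
    have s2 : ∫ t in B ∩ Icc 1 r, (v (M * t) * t⁻¹ - v t * t⁻¹)
        ≤ ∫ t in Icc 1 r, (v (M * t) * t⁻¹ - v t * t⁻¹) := by
      refine setIntegral_mono_set ?_ ?_ (LE.le.eventuallyLE inter_subset_right)
      · rw [integrableOn_Icc_iff_integrableOn_Ioc,
          ← intervalIntegrable_iff_integrableOn_Ioc_of_le hr]
        exact (hint hvM one_pos hr).sub (hint hv one_pos hr)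
      · filter_upwards [ae_restrict_mem measurableSet_Icc] with t ht
        have ht0 : 0 < t := by linarith [ht.1]
        simp only [Pi.zero_apply]
        rw [← sub_mul]
        exact mul_nonneg (sub_nonneg.2 (hv (le_mul_of_one_le_left ht0.le hM))) (inv_nonneg.2 ht0.le)
    have s3 : ∫ t in Icc 1 r, (v (M * t) * t⁻¹ - v t * t⁻¹)
        = (∫ t in (1:ℝ)..r, v (M * t) * t⁻¹) - ∫ t in (1:ℝ)..r, v t * t⁻¹ := by
      rw [integral_Icc_eq_integral_Ioc, ← intervalIntegral.integral_of_le hr,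
        intervalIntegral.integral_sub (hint hvM one_pos hr) (hint hv one_pos hr)]
    have s4 : ∫ t in (1:ℝ)..r, v (M * t) * t⁻¹ = ∫ t in M..(M * r), v t * t⁻¹ := by
      have := intervalIntegral.integral_comp_mul_left (a := 1) (b := r)
        (fun t => v t * t⁻¹) hM0.ne'
      rw [mul_one, smul_eq_mul] at this
      rw [eq_inv_mul_iff_mul_eq₀ hM0.ne', ← intervalIntegral.integral_const_mul] at this
      rw [← this]
      congr 1; ext t
      rw [mul_inv]; field_simp
    have s5 : (∫ t in M..(M * r), v t * t⁻¹) - ∫ t in (1:ℝ)..r, v t * t⁻¹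
        = (∫ t in r..(M * r), v t * t⁻¹) - ∫ t in (1:ℝ)..M, v t * t⁻¹ := by
      have e1 := intervalIntegral.integral_add_adjacent_intervals
        (hint hv one_pos hM) (hint hv hM0 (le_mul_of_one_le_right hM0.le hr))
      have e2 := intervalIntegral.integral_add_adjacent_intervals
        (hint hv one_pos hr) (hint hv hr0 hrM)
      linarith
    have s6 : 0 ≤ ∫ t in (1:ℝ)..M, v t * t⁻¹ :=
      intervalIntegral.integral_nonneg hM fun t ht =>
        mul_nonneg (hv0 t) (inv_nonneg.2 (by linarith [ht.1]))
    have s7 : ∫ t in r..(M * r), v t * t⁻¹ ≤ v (M * r) * Real.log M := by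
      have : ∫ t in r..(M * r), v (M * r) * t⁻¹ = v (M * r) * Real.log M := by
        rw [intervalIntegral.integral_const_mul, integral_inv_of_pos hr0 (by positivity),
          mul_div_cancel_right₀ _ hr0.ne']
      rw [← this]
      refine intervalIntegral.integral_mono_on hrM (hint hv hr0 hrM)
        (hint monotone_const hr0 hrM) fun t ht => ?_
      exact mul_le_mul_of_nonneg_right (hv ht.2) (inv_nonneg.2 (by linarith [ht.1]))
    linarith
  refine ⟨hBm, ?_⟩
  have hlim : Tendsto (fun r : ℝ => η⁻¹ * Real.log M *
      (v (M * r) / Real.log (M * r) * ((Real.log M + Real.log r) / Real.log r))) atTop (𝓝 0) := by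
    have h1 : Tendsto (fun r : ℝ => v (M * r) / Real.log (M * r)) atTop (𝓝 0) :=
      hlog.comp (tendsto_id.const_mul_atTop hM0)
    have h2 : Tendsto (fun r : ℝ => (Real.log M + Real.log r) / Real.log r) atTop (𝓝 1) := by
      have : Tendsto (fun r : ℝ => Real.log M / Real.log r + 1) atTop (𝓝 (0 + 1)) :=
        (Real.tendsto_log_atTop.const_div_atTop _).add_const 1
      rw [zero_add] at this
      refine this.congr' ?_
      filter_upwards [eventually_gt_atTop 1] with r hr
      rw [add_div, div_self (Real.log_pos hr).ne']
    simpa using (h1.mul h2).const_mul (η⁻¹ * Real.log M)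
  refine squeeze_zero' ?_ ?_ hlim
  · filter_upwards [eventually_ge_atTop 1] with r hr
    exact div_nonneg (logMass_nonneg hBm r) (Real.log_nonneg hr)
  · filter_upwards [eventually_gt_atTop 1] with r hr
    have hl := Real.log_pos hr
    have hl2 : 0 < Real.log M + Real.log r := by linarith [Real.log_nonneg hM]
    rw [Real.log_mul hM0.ne' (by linarith), div_mul_div_cancel₀ hl2.ne', ← mul_div_assoc]
    apply div_le_div_of_nonneg_right _ hl.le
    rw [mul_assoc, ← div_eq_inv_mul, le_div_iff₀ hη]
    linarith [bound r hr.le]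

end HahnNevanlinna

/-! ### Circle means of logarithms of affine functions, and oscillation of harmonic functions. -/

namespace HahnNevanlinna

open MeasureTheory Set Real Metric

/-- The derivative q ≠ 0 makes the map nowhere locally constant. This carries identities for f that
hold off a discrete set over to f(qz+c). -/
lemma affine_preimage_mem_codiscreteWithin {q : ℂ} (hq : q ≠ 0) (c : ℂ) {U V s : Set ℂ}
    (hUV : (fun z => q * z + c) '' U ⊆ V) (hs : s ∈ codiscreteWithin V) :
    (fun z => q * z + c) ⁻¹' s ∈ codiscreteWithin U := by
  refine AnalyticOnNhd.preimage_mem_codiscreteWithin (fun z _ => by fun_prop) ?_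
    (codiscreteWithin_mono hUV hs)
  intro x _ hconst
  obtain ⟨b, hb⟩ := eventuallyConst_iff_exists_eventuallyEq.1 hconst
  have h1 : HasDerivAt (fun z => q * z + c) q x := by
    simpa using ((hasDerivAt_id x).const_mul q).add_const c
  have h2 := h1.congr_of_eventuallyEq hb.symm
  exact hq (h2.unique (hasDerivAt_const x b))

lemma circleIntegrable_log_norm_affine (α β : ℂ) (r : ℝ) :
    CircleIntegrable (fun z => log ‖α * z + β‖) 0 r :=
  MeromorphicOn.circleIntegrable_log_norm fun z _ => by fun_prop

/-- The mean of `log ‖α z + β‖` over a circle centred at the origin. -/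
lemma circleAverage_log_norm_affine {α : ℂ} (hα : α ≠ 0) (β : ℂ) {r : ℝ} (hr : 0 < r) :
    circleAverage (fun z => log ‖α * z + β‖) 0 r = log (max (‖α‖ * r) ‖β‖) := by
  have hα' : 0 < ‖α‖ := norm_pos_iff.2 hα
  have h1 : (fun z => log ‖α * z + β‖) =ᶠ[codiscreteWithin (sphere (0 : ℂ) |r|)]
      fun z => log ‖α‖ + log ‖z - (-β / α)‖ := by
    filter_upwards [compl_singleton_mem_codiscreteWithin (s := sphere (0 : ℂ) |r|) (-β / α)]
      with z hz
    have hz' : z - (-β / α) ≠ 0 := sub_ne_zero.2 hz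
    rw [← log_mul hα'.ne' (norm_ne_zero_iff.2 hz'), ← norm_mul]
    congr 2
    field_simp
    ring
  rw [circleAverage_congr_codiscreteWithin h1 hr.ne', circleAverage_fun_add
    (circleIntegrable_const _ _ _) (MeromorphicOn.circleIntegrable_log_norm fun z _ => by fun_prop),
    circleAverage_const, circleAverage_log_norm_sub_const_eq_log_radius_add_posLog hr.ne',
    posLog_eq_log_max_one (by positivity), ← log_mul hr.ne' (by positivity),
    ← log_mul hα'.ne' (by positivity), mul_max_of_nonneg _ _ hr.le, mul_max_of_nonneg _ _ hα'.le]
  congr 2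
  · simp
  · rw [zero_sub, norm_neg, norm_div, norm_neg]
    field_simp

/-- On a circle centred at the origin, `log ‖α z + β‖` deviates from its mean by a bounded amount
on average. -/
lemma circleAverage_abs_log_norm_affine_sub_le {α : ℂ} (hα : α ≠ 0) (β : ℂ) {r : ℝ} (hr : 0 < r)
    (h : 1 ≤ max (‖α‖ * r) ‖β‖) :
    circleAverage (fun z => |log ‖α * z + β‖ - log (max (‖α‖ * r) ‖β‖)|) 0 r ≤ 2 * log 2 := by
  set m := max (‖α‖ * r) ‖β‖ with hm
  have hi := circleIntegrable_log_norm_affine α β r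
  have hi2 : CircleIntegrable (fun z => log ‖α * z + β‖ - log m) 0 r :=
    hi.sub (circleIntegrable_const _ _ _)
  -- X = log ‖αz+β‖ - log m has mean zero and X ≤ log 2, hence |X| ≤ 2 log 2 - X pointwise, and the
  -- right side has mean 2 log 2.
  have hmean : circleAverage (fun z => 2 * log 2 - (log ‖α * z + β‖ - log m)) 0 r = 2 * log 2 := by
    rw [circleAverage_fun_sub (circleIntegrable_const _ _ _) hi2,
      circleAverage_fun_sub hi (circleIntegrable_const _ _ _), circleAverage_const,
      circleAverage_const, circleAverage_log_norm_affine hα β hr]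
    ring
  rw [← hmean]
  refine circleAverage_mono hi2.abs ((circleIntegrable_const _ _ _).sub hi2) fun z hz => ?_
  have hz' : ‖z‖ = r := by simpa [abs_of_pos hr] using hz
  have hX : log ‖α * z + β‖ ≤ log 2 + log m := by
    -- At a zero on the circle Lean's `log 0 = 0` must still obey the upper bound; this is where m ≥
    -- 1 is needed.
    rcases eq_or_ne (‖α * z + β‖) 0 with h0 | h0
    · rw [h0, log_zero]
      have := log_nonneg h
      have := log_nonneg (one_le_two (α := ℝ))
      linarith
    · rw [← log_mul two_ne_zero (by linarith)]
      apply log_le_log (lt_of_le_of_ne (norm_nonneg _) (Ne.symm h0))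
      calc ‖α * z + β‖ ≤ ‖α‖ * r + ‖β‖ := by
            grw [norm_add_le, norm_mul, hz']
        _ ≤ 2 * m := by
            linarith [le_max_left (‖α‖ * r) ‖β‖, le_max_right (‖α‖ * r) ‖β‖]
  have := log_nonneg (one_le_two (α := ℝ))
  rw [abs_le']
  constructor <;> linarith

/-- Each of the two maxima is at most (1 + ‖c‖)/‖q‖ times the other, by the triangle inequality. -/
lemma abs_log_max_affine_sub_le {q c : ℂ} (hq : q ≠ 0) (hq1 : ‖q‖ ≤ 1) (u : ℂ) {r : ℝ}
    (hr : 1 ≤ ‖q‖ * r) :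
    |log (max (‖q‖ * r) ‖c - u‖) - log (max r ‖u‖)| ≤ log ((1 + ‖c‖) / ‖q‖) := by
  have hq' : 0 < ‖q‖ := norm_pos_iff.2 hq
  have hr0 : 0 < r := pos_of_mul_pos_right (by linarith) hq'.le
  have hqr : ‖q‖ * r ≤ r := mul_le_of_le_one_left hr0.le hq1
  have hr1 : 1 ≤ r := hr.trans hqr
  set m := max (‖q‖ * r) ‖c - u‖ with hm
  set m' := max r ‖u‖ with hm'
  have m1 : 1 ≤ m := hr.trans (le_max_left _ _)
  have m1' : 1 ≤ m' := hr1.trans (le_max_left _ _)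
  have hc := norm_nonneg c
  have hK : 1 ≤ (1 + ‖c‖) / ‖q‖ := by rw [le_div_iff₀ hq']; linarith
  have hKc : 1 + ‖c‖ ≤ (1 + ‖c‖) / ‖q‖ := by
    rw [le_div_iff₀ hq']; exact mul_le_of_le_one_right (by positivity) hq1
  have e1 : m ≤ (1 + ‖c‖) / ‖q‖ * m' := by
    have : m ≤ (1 + ‖c‖) * m' := by
      refine max_le ?_ ?_
      · nlinarith [le_max_left r ‖u‖]
      · have := norm_sub_le c u
        nlinarith [le_max_right r ‖u‖]
    exact this.trans (mul_le_mul_of_nonneg_right hKc (by linarith))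
  have e2 : m' ≤ (1 + ‖c‖) / ‖q‖ * m := by
    refine max_le ?_ ?_
    · rw [div_mul_eq_mul_div, le_div_iff₀ hq']
      nlinarith [le_max_left (‖q‖ * r) ‖c - u‖]
    · have h1 : ‖u‖ ≤ ‖c‖ + ‖c - u‖ := by
        have := norm_sub_le c (c - u)
        rwa [sub_sub_cancel] at this
      have : ‖u‖ ≤ (1 + ‖c‖) * m := by nlinarith [le_max_right (‖q‖ * r) ‖c - u‖]
      exact this.trans (mul_le_mul_of_nonneg_right hKc (by linarith))
  have l1 := log_le_log (by linarith) e1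
  have l2 := log_le_log (by linarith) e2
  rw [log_mul (by linarith) (by linarith)] at l1 l2
  rw [abs_le']
  constructor <;> linarith

/-- Each logarithm is close in mean to its circle average, and the two averages are close to each
other. The bound does not depend on u, so that a sum over zeros and poles is controlled by their
number alone. -/
lemma circleAverage_abs_log_norm_shift_sub_le {q c : ℂ} (hq : q ≠ 0) (hq1 : ‖q‖ ≤ 1) (u : ℂ)
    {r : ℝ} (hr : 1 ≤ ‖q‖ * r) :
    circleAverage (fun z => |log ‖q * z + c - u‖ - log ‖z - u‖|) 0 r ≤
      4 * log 2 + log ((1 + ‖c‖) / ‖q‖) := by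
  have hq' : 0 < ‖q‖ := norm_pos_iff.2 hq
  have hr0 : 0 < r := pos_of_mul_pos_right (by linarith) hq'.le
  have hqr : ‖q‖ * r ≤ r := mul_le_of_le_one_left hr0.le hq1
  have i1 := circleIntegrable_log_norm_affine q (c - u) r
  have i2 := circleIntegrable_log_norm_affine 1 (-u) r
  set m := max (‖q‖ * r) ‖c - u‖ with hm
  set m' := max (‖(1 : ℂ)‖ * r) ‖-u‖ with hm'
  have j1 : CircleIntegrable (fun z => |log ‖q * z + (c - u)‖ - log m|) 0 r :=
    (i1.sub (circleIntegrable_const _ _ _)).abs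
  have j2 : CircleIntegrable (fun z => |log ‖1 * z + -u‖ - log m'|) 0 r :=
    (i2.sub (circleIntegrable_const _ _ _)).abs
  have b1 := circleAverage_abs_log_norm_affine_sub_le hq (c - u) hr0 (hr.trans (le_max_left _ _))
  have b2 := circleAverage_abs_log_norm_affine_sub_le one_ne_zero (-u) hr0
    (le_trans (by simpa using hr.trans hqr) (le_max_left _ _))
  have b3 : |log m - log m'| ≤ log ((1 + ‖c‖) / ‖q‖) := by
    have := abs_log_max_affine_sub_le (c := c) hq hq1 u hr
    simpa [hm, hm'] using this
  have e : ∀ z, |log ‖q * z + c - u‖ - log ‖z - u‖| ≤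
      |log ‖q * z + (c - u)‖ - log m| + |log ‖1 * z + -u‖ - log m'| +
        log ((1 + ‖c‖) / ‖q‖) := by
    intro z
    rw [add_sub_assoc, one_mul, ← sub_eq_add_neg]
    have := abs_sub_abs_le_abs_sub (log ‖q * z + (c - u)‖ - log ‖z - u‖) (log m - log m')
    have h2 := abs_sub (log ‖q * z + (c - u)‖ - log m) (log ‖z - u‖ - log m')
    have h3 : log ‖q * z + (c - u)‖ - log m - (log ‖z - u‖ - log m') =
      log ‖q * z + (c - u)‖ - log ‖z - u‖ - (log m - log m') := by ring
    rw [h3] at h2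
    linarith
  calc _ ≤ circleAverage (fun z => |log ‖q * z + (c - u)‖ - log m| +
        |log ‖1 * z + -u‖ - log m'| + log ((1 + ‖c‖) / ‖q‖)) 0 r := by
        refine circleAverage_mono ?_ ((j1.add j2).add (circleIntegrable_const _ _ _))
          fun z _ => e z
        refine CircleIntegrable.abs (CircleIntegrable.sub ?_ ?_)
        · simpa only [add_sub_assoc] using i1
        · simpa only [one_mul, ← sub_eq_add_neg] using i2
    _ = circleAverage (fun z => |log ‖q * z + (c - u)‖ - log m|) 0 r +
        circleAverage (fun z => |log ‖1 * z + -u‖ - log m'|) 0 r +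
          log ((1 + ‖c‖) / ‖q‖) := by
        have j12 : CircleIntegrable (fun z => |log ‖q * z + (c - u)‖ - log m| +
          |log ‖1 * z + -u‖ - log m'|) 0 r := j1.add j2
        rw [circleAverage_fun_add j12 (circleIntegrable_const _ _ _),
          circleAverage_fun_add j1 j2, circleAverage_const]
    _ ≤ _ := by linarith

/-- A harmonic function oscillates little near the centre of a large disc, relative to its mean
absolute value on the boundary. -/
lemma abs_sub_center_le_of_harmonicOnNhd {φ : ℂ → ℝ} {R ρ : ℝ}
    (hφ : InnerProductSpace.HarmonicOnNhd φ (closedBall 0 R)) (hR : 0 < R) (hρ : 2 * ρ ≤ R)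
    {z : ℂ} (hz : ‖z‖ ≤ ρ) :
    |φ z - φ 0| ≤ 4 * ρ / R * circleAverage (fun w => |φ w|) 0 R := by
  have hzR : ‖z‖ < R := by linarith [norm_nonneg z]
  have hzb : z ∈ ball (0 : ℂ) R := by simpa using hzR
  have hcont : ContinuousOn φ (sphere 0 |R|) := fun w hw =>
    (hφ w (by rw [abs_of_pos hR] at hw; exact sphere_subset_closedBall hw)).1.continuousAt
      |>.continuousWithinAt
  have hi : CircleIntegrable φ 0 R := hcont.circleIntegrable'
  have hk : ContinuousOn (Complex.re ∘ herglotzRieszKernel 0 z) (sphere 0 |R|) :=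
    Complex.continuous_re.comp_continuousOn (continuousOn_herglotzRieszKernel_sphere hzb)
  have hi2 : CircleIntegrable ((Complex.re ∘ herglotzRieszKernel 0 z) • φ) 0 R :=
    (hk.smul hcont).circleIntegrable'
  have h0 : φ 0 = circleAverage φ 0 R := by
    rw [← InnerProductSpace.HarmonicOnNhd.circleAverage_re_herglotzRieszKernel_smul hφ
      (mem_ball_self hR)]
    refine circleAverage_congr_sphere fun w hw => ?_
    have hw0 : w ≠ 0 := by
      rintro rfl
      simp [abs_of_pos hR] at hw; exact hR.ne hw
    simp [herglotzRieszKernel_def, hw0]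
  rw [← InnerProductSpace.HarmonicOnNhd.circleAverage_re_herglotzRieszKernel_smul hφ hzb, h0,
    ← circleAverage_sub hi2 hi]
  refine abs_circleAverage_le_circleAverage_abs.trans ?_
  rw [← smul_eq_mul, ← circleAverage_fun_smul]
  refine circleAverage_mono (hi2.sub hi).abs (hi.abs.const_fun_smul) fun w hw => ?_
  have hw' : w ∈ sphere (0 : ℂ) R := by rwa [abs_of_pos hR] at hw
  have u1 := re_herglotzRieszKernel_le hw' hzb
  have u2 := le_re_herglotzRieszKernel hw' hzb
  simp only [sub_zero] at u1 u2
  -- The Poisson kernel lies between (R-‖z‖)/(R+‖z‖) and its reciprocal, both within 4ρ/R of 1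
  -- because 2ρ ≤ R; its value for the centre is exactly 1.
  have : |((w + z) / (w - z)).re - 1| ≤ 4 * ρ / R := by
    have hzn := norm_nonneg z
    have v1 : (R + ‖z‖) / (R - ‖z‖) ≤ 1 + 4 * ρ / R := by
      rw [div_le_iff₀ (by linarith)]
      have : (1 + 4 * ρ / R) * (R - ‖z‖) = R - ‖z‖ + 4 * ρ * (R - ‖z‖) / R := by
        field_simp
      rw [this]
      have : 2 * ‖z‖ ≤ 4 * ρ * (R - ‖z‖) / R := by
        rw [le_div_iff₀ hR]; nlinarith
      linarith
    have v2 : 1 - 4 * ρ / R ≤ (R - ‖z‖) / (R + ‖z‖) := by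
      rw [le_div_iff₀ (by linarith)]
      have : (1 - 4 * ρ / R) * (R + ‖z‖) = R + ‖z‖ - 4 * ρ * (R + ‖z‖) / R := by
        field_simp
      rw [this]
      have : 2 * ‖z‖ ≤ 4 * ρ * (R + ‖z‖) / R := by
        rw [le_div_iff₀ hR]; nlinarith
      linarith
    rw [abs_le]
    constructor <;> linarith
  have e : |(Complex.re ∘ herglotzRieszKernel 0 z) • φ - φ| w =
      |((w + z) / (w - z)).re - 1| * |φ w| := by
    rw [Pi.abs_apply, ← abs_mul]
    simp only [herglotzRieszKernel_def, Pi.sub_apply, Pi.mul_apply, smul_eq_mul,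
      Function.comp_apply, sub_zero, sub_mul, one_mul]
  rw [e, smul_eq_mul]
  exact mul_le_mul_of_nonneg_right this (abs_nonneg _)

end HahnNevanlinna

/-! ### Shift quotients estimated through zeros, poles and a harmonic remainder. -/

namespace HahnNevanlinna

open MeasureTheory Set Real Metric ValueDistribution MeromorphicOn

lemma circleAverage_const_mul (a : ℝ) (f : ℂ → ℝ) (c : ℂ) (R : ℝ) :
    circleAverage (fun z => a * f z) c R = a * circleAverage f c R := by
  simpa only [smul_eq_mul] using circleAverage_fun_smul (a := a) (f := f) (c := c) (R := R)

lemma circleAverage_abs_log_norm_eq {f : ℂ → ℂ} (hf : Meromorphic f) (R : ℝ) :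
    circleAverage (fun z => |log ‖f z‖|) 0 R = proximity f ⊤ R + proximity f⁻¹ ⊤ R := by
  rw [proximity_top, proximity_top, ← circleAverage_fun_add
    (MeromorphicOn.circleIntegrable_posLog_norm fun z _ => hf z)
    (MeromorphicOn.circleIntegrable_posLog_norm fun z _ => hf.inv z)]
  congr 1
  ext z
  simp only [Pi.inv_apply, norm_inv, posLog_apply, log_inv]
  rcases le_total 0 (log ‖f z‖) with h | h
  · rw [abs_of_nonneg h, max_eq_right h, max_eq_left (by linarith), add_zero]
  · rw [abs_of_nonpos h, max_eq_left h, max_eq_right (by linarith), zero_add]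

/-- Difference version of the lemma on the logarithmic derivative, before choosing radii. -/
theorem proximity_shift_quotient_le {f : ℂ → ℂ} (hf : Meromorphic f)
    (hord : ∀ z, meromorphicOrderAt f z ≠ ⊤) {q c : ℂ} (hq : q ≠ 0) (hq1 : ‖q‖ ≤ 1) {r R : ℝ}
    (hr : 1 ≤ ‖q‖ * r) (hrc : ‖c‖ ≤ r) (hR : 4 * r ≤ R) {s : Finset ℂ}
    (hs : (divisor f (closedBall 0 R)).support ⊆ s) :
    proximity (fun z => f (q * z + c) / f z) ⊤ r ≤
      (∑ u ∈ s, |(divisor f (closedBall 0 R) u : ℝ)|) * (4 * log 2 + log ((1 + ‖c‖) / ‖q‖)) +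
      16 * r / R * (proximity f ⊤ R + proximity f⁻¹ ⊤ R +
        (∑ u ∈ s, |(divisor f (closedBall 0 R) u : ℝ)|) * (2 * log 2)) := by
  have hq' : 0 < ‖q‖ := norm_pos_iff.2 hq
  have hr0 : 0 < r := pos_of_mul_pos_right (by linarith) hq'.le
  have hqr : ‖q‖ * r ≤ r := mul_le_of_le_one_left hr0.le hq1
  have hR0 : 0 < R := by linarith
  set U := closedBall (0 : ℂ) R with hU
  set D := divisor f U with hD
  have hfU : MeromorphicOn f U := fun z _ => hf z
  obtain ⟨h, hh, hh0, heq⟩ := hfU.extract_zeros_poles (fun u => hord u)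
    (D.finiteSupport (isCompact_closedBall 0 R))
  have hlog : ∀ᶠ z in codiscreteWithin U,
      log ‖f z‖ = ∑ u ∈ s, D u * log ‖z - u‖ + log ‖h z‖ := by
    filter_upwards [extract_zeros_poles_log hh0 heq] with z hz
    rw [hz, Pi.add_apply, finsum_eq_sum_of_support_subset (s := s), Finset.sum_apply]
    intro u hu
    apply hs
    rw [Function.mem_support] at hu ⊢
    contrapose! hu
    ext w
    simp [← hD, hu]
  -- The multiple of log R is moved into the harmonic part so that the remaining terms log ‖z-u‖ -
  -- log R have bounded mean modulus on |z| = R; it cancels from the shift quotient.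
  set φ : ℂ → ℝ := fun z => log ‖h z‖ + (∑ u ∈ s, (D u : ℝ)) * log R with hφdef
  have hlogφ : ∀ᶠ z in codiscreteWithin U,
      log ‖f z‖ = ∑ u ∈ s, D u * (log ‖z - u‖ - log R) + φ z := by
    filter_upwards [hlog] with z hz
    rw [hz, hφdef]
    simp only [mul_sub, Finset.sum_sub_distrib, Finset.sum_mul]
    ring
  have hφharm : InnerProductSpace.HarmonicOnNhd φ U := fun z hz =>
    ((hh z hz).harmonicAt_log_norm (hh0 ⟨z, hz⟩)).add
      (InnerProductSpace.harmonicAt_const _)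
  have hsphereR : sphere (0 : ℂ) |R| ⊆ U := by
    rw [abs_of_pos hR0]; exact sphere_subset_closedBall
  have hsphere : sphere (0 : ℂ) |r| ⊆ U := by
    rw [abs_of_pos hr0]; exact sphere_subset_closedBall.trans (closedBall_subset_closedBall (by linarith))
  have hDs : ∀ u ∈ s, u ∉ U → D u = 0 := fun u _ hu => D.apply_eq_zero_of_notMem hu
  have iu (u : ℂ) (ρ : ℝ) : CircleIntegrable (fun z => log ‖z - u‖) 0 ρ :=
    MeromorphicOn.circleIntegrable_log_norm fun z _ => by fun_prop
  have iq (u : ℂ) (ρ : ℝ) : CircleIntegrable (fun z => log ‖q * z + c - u‖) 0 ρ :=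
    MeromorphicOn.circleIntegrable_log_norm fun z _ => by fun_prop
  have ifR : CircleIntegrable (fun z => |log ‖f z‖|) 0 R :=
    (MeromorphicOn.circleIntegrable_log_norm fun z _ => hf z).abs
  have iuR (u : ℂ) : CircleIntegrable (fun z => |(D u : ℝ)| * |log ‖z - u‖ - log R|) 0 R :=
    ((iu u R).sub (circleIntegrable_const _ _ _)).abs.const_fun_smul
  set n := ∑ u ∈ s, |(D u : ℝ)| with hn
  set A := circleAverage (fun z => |φ z|) 0 R with hA
  have hAle : A ≤ proximity f ⊤ R + proximity f⁻¹ ⊤ R + n * (2 * log 2) := by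
    have e1 : (fun z => |φ z|) =ᶠ[codiscreteWithin (sphere (0 : ℂ) |R|)]
        fun z => |log ‖f z‖ - ∑ u ∈ s, D u * (log ‖z - u‖ - log R)| := by
      filter_upwards [codiscreteWithin_mono hsphereR hlogφ] with z hz
      rw [hz, add_sub_cancel_left]
    have isum : CircleIntegrable
        (fun z => ∑ u ∈ s, |(D u : ℝ)| * |log ‖z - u‖ - log R|) 0 R :=
      CircleIntegrable.fun_sum _ fun u _ => iuR u
    rw [hA, circleAverage_congr_codiscreteWithin e1 hR0.ne', ← circleAverage_abs_log_norm_eq hf]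
    calc _ ≤ circleAverage (fun z => |log ‖f z‖| +
          ∑ u ∈ s, |(D u : ℝ)| * |log ‖z - u‖ - log R|) 0 R := by
          refine circleAverage_mono ?_ (ifR.add isum) fun z _ => ?_
          · refine CircleIntegrable.abs (CircleIntegrable.sub
              (MeromorphicOn.circleIntegrable_log_norm fun z _ => hf z)
              (CircleIntegrable.fun_sum _ fun u _ => ?_))
            exact ((iu u R).sub (circleIntegrable_const _ _ _)).const_fun_smul
          · refine (abs_sub _ _).trans (add_le_add_right ?_ _)
            refine (Finset.abs_sum_le_sum_abs _ _).trans (Finset.sum_le_sum fun u _ => ?_)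
            rw [abs_mul]
      _ = circleAverage (fun z => |log ‖f z‖|) 0 R +
          ∑ u ∈ s, |(D u : ℝ)| * circleAverage (fun z => |log ‖z - u‖ - log R|) 0 R := by
          rw [circleAverage_fun_add ifR isum, circleAverage_fun_sum fun u _ => iuR u]
          congr 1
          exact Finset.sum_congr rfl fun u _ => circleAverage_const_mul _ _ _ _
      _ ≤ _ := by
          rw [hn, Finset.sum_mul]
          refine add_le_add_right (Finset.sum_le_sum fun u hu => ?_) _
          by_cases huU : u ∈ U
          · refine mul_le_mul_of_nonneg_left ?_ (abs_nonneg _)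
            -- For u in the disc the mean of log ‖z-u‖ over |z| = R is exactly log R, which is the
            -- normalisation chosen in φ.
            have hm : max (‖(1 : ℂ)‖ * R) ‖-u‖ = R := by
              rw [norm_one, one_mul, norm_neg, max_eq_left]
              simpa [hU] using huU
            have := circleAverage_abs_log_norm_affine_sub_le one_ne_zero (-u) hR0
              (by rw [hm]; linarith)
            rw [hm] at this
            simpa only [one_mul, ← sub_eq_add_neg] using this
          · simp [hDs u hu huU]
  -- The disc of radius 2r contains both z and qz+c when ‖z‖ = r. Two comparisons with the centre,
  -- each costing 4(2r)/R, give the factor 16r/R.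
  have hosc {z w : ℂ} (hz : ‖z‖ ≤ 2 * r) (hw : ‖w‖ ≤ 2 * r) : φ z - φ w ≤ 16 * r / R * A := by
    have h1 := abs_sub_center_le_of_harmonicOnNhd hφharm hR0 (by linarith) hz
    have h2 := abs_sub_center_le_of_harmonicOnNhd hφharm hR0 (by linarith) hw
    rw [abs_le] at h1 h2
    have : 16 * r / R * A = 4 * (2 * r) / R * A + 4 * (2 * r) / R * A := by ring
    linarith [h1.2, h2.1]
  have hA0 : 0 ≤ A := circleAverage_nonneg_of_nonneg fun z _ => abs_nonneg _
  have himg : (fun z => q * z + c) '' sphere (0 : ℂ) |r| ⊆ U := by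
    rintro _ ⟨z, hz, rfl⟩
    have hz' : ‖z‖ = r := by simpa [abs_of_pos hr0] using hz
    have : ‖q * z + c‖ ≤ R := by
      grw [norm_add_le, norm_mul, hz']; linarith
    simpa [hU] using this
  have iT (u : ℂ) : CircleIntegrable
      (fun z => |(D u : ℝ)| * |log ‖q * z + c - u‖ - log ‖z - u‖|) 0 r :=
    ((iq u r).sub (iu u r)).abs.const_fun_smul
  have isumT : CircleIntegrable
      (fun z => ∑ u ∈ s, |(D u : ℝ)| * |log ‖q * z + c - u‖ - log ‖z - u‖|) 0 r :=
    CircleIntegrable.fun_sum _ fun u _ => iT u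
  have hmer : Meromorphic fun z => f (q * z + c) / f z := by
    have : Meromorphic (fun z => f (q * z + c)) := fun z =>
      (hf (q * z + c)).comp_analyticAt (f := f) (g := fun z => q * z + c) (by fun_prop)
    exact this.div hf
  have hne : ∀ᶠ z in codiscreteWithin U, f z ≠ 0 :=
    hfU.eventually_codiscreteWithin_apply_ne_zero fun u _ => hord u
  set ψ : ℂ → ℝ := fun z => max 0 (∑ u ∈ s, D u * (log ‖q * z + c - u‖ - log ‖z - u‖) +
    (φ (q * z + c) - φ z)) with hψ
  have e2 : (fun z => log⁺ ‖f (q * z + c) / f z‖) =ᶠ[codiscreteWithin (sphere (0 : ℂ) |r|)] ψ := by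
    filter_upwards [codiscreteWithin_mono hsphere hlogφ, codiscreteWithin_mono hsphere hne,
      affine_preimage_mem_codiscreteWithin hq c himg hlogφ,
      affine_preimage_mem_codiscreteWithin hq c himg hne] with z h1 h2 h3 h4
    have h3' : log ‖f (q * z + c)‖ =
      ∑ u ∈ s, D u * (log ‖q * z + c - u‖ - log R) + φ (q * z + c) := h3
    have h4' : f (q * z + c) ≠ 0 := h4
    rw [posLog_apply, norm_div, log_div (norm_ne_zero_iff.2 h4') (norm_ne_zero_iff.2 h2), h1, h3',
      hψ]
    simp only [mul_sub, Finset.sum_sub_distrib]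
    congr 1
    ring
  have iψ : CircleIntegrable ψ 0 r :=
    CircleIntegrable.congr_codiscreteWithin e2
      (MeromorphicOn.circleIntegrable_posLog_norm fun z _ => hmer z)
  rw [proximity_top, circleAverage_congr_codiscreteWithin e2 hr0.ne']
  calc circleAverage ψ 0 r ≤ circleAverage (fun z =>
        ∑ u ∈ s, |(D u : ℝ)| * |log ‖q * z + c - u‖ - log ‖z - u‖| + 16 * r / R * A) 0 r := by
        refine circleAverage_mono iψ (isumT.add (circleIntegrable_const _ _ _)) fun z hz => ?_
        have hz' : ‖z‖ = r := by simpa [abs_of_pos hr0] using hz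
        refine max_le (by positivity) (add_le_add ?_ (hosc ?_ (by linarith)))
        · exact Finset.sum_le_sum fun u _ => (le_abs_self _).trans (abs_mul _ _).le
        · grw [norm_add_le, norm_mul, hz']; linarith
    _ = ∑ u ∈ s, |(D u : ℝ)| *
          circleAverage (fun z => |log ‖q * z + c - u‖ - log ‖z - u‖|) 0 r + 16 * r / R * A := by
        rw [circleAverage_fun_add isumT (circleIntegrable_const _ _ _), circleAverage_const,
          circleAverage_fun_sum fun u _ => iT u]
        congr 1
        exact Finset.sum_congr rfl fun u _ => circleAverage_const_mul _ _ _ _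
    _ ≤ _ := by
        refine add_le_add ?_ (mul_le_mul_of_nonneg_left hAle (by positivity))
        rw [hn, Finset.sum_mul]
        exact Finset.sum_le_sum fun u _ => mul_le_mul_of_nonneg_left
          (circleAverage_abs_log_norm_shift_sub_le hq hq1 u hr) (abs_nonneg _)

end HahnNevanlinna

/-! ### Counting functions as weighted sums, and shift quotients in terms of the characteristic. -/

namespace HahnNevanlinna

open MeasureTheory Set Real Metric ValueDistribution MeromorphicOn
open Function (locallyFinsupp)
open Function.locallyFinsuppWithin (toClosedBall toClosedBall_eval_within)

/-- With the convention `log 0 = 0` the separate term n(0) log r is absorbed as the weight of the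
origin. -/
lemma logCounting_eq_sum (D : locallyFinsupp ℂ ℤ) {r : ℝ} (hr : 0 < r) {s : Finset ℂ}
    (hs : (toClosedBall r D).support ⊆ s) :
    Function.locallyFinsuppWithin.logCounting D r =
      ∑ z ∈ s, (toClosedBall r D z : ℝ) * (log r - log ‖z‖) := by
  have h1 : ∀ z ∈ s, (toClosedBall r D z : ℝ) * (log r - log ‖z‖) =
      (toClosedBall r D z : ℝ) * log (r * ‖z‖⁻¹) +
        if 0 = z then (toClosedBall r D 0 : ℝ) * log r else 0 := by
    intro z _
    split_ifs with h
    · subst h; simp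
    · rw [log_mul hr.ne' (inv_ne_zero (norm_ne_zero_iff.2 (Ne.symm h))), log_inv]; ring
  rw [Finset.sum_congr rfl h1, Finset.sum_add_distrib, Finset.sum_ite_eq]
  have h0 : toClosedBall r D 0 = D 0 := toClosedBall_eval_within D (by simp)
  simp only [Function.locallyFinsuppWithin.logCounting, AddMonoidHom.coe_mk, ZeroHom.coe_mk]
  rw [finsum_eq_sum_of_support_subset (s := s)]
  · congr 1
    split_ifs with h
    · rw [h0]
    · have : toClosedBall r D 0 = 0 := by
        by_contra hne; exact h (hs hne)
      rw [← h0, this]; simp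
  · intro z hz
    apply hs
    rw [Function.mem_support] at hz ⊢
    contrapose! hz
    simp [hz]

/-- For an effective divisor and r ≥ 1 all weights log r - log ‖z‖ in the disc are nonnegative, the
one at the origin included, so omitting points only lowers the sum. -/
lemma sum_le_logCounting {D : locallyFinsupp ℂ ℤ} (hD : 0 ≤ D) {r : ℝ} (hr : 1 ≤ r)
    {s : Finset ℂ} (hs : ∀ z ∈ s, ‖z‖ ≤ r) :
    ∑ z ∈ s, (D z : ℝ) * (log r - log ‖z‖) ≤ Function.locallyFinsuppWithin.logCounting D r := by
  classical
  have hr0 : 0 < r := by linarith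
  have hfin : (toClosedBall r D).support.Finite :=
    (toClosedBall r D).finiteSupport (isCompact_closedBall 0 |r|)
  have hball {z : ℂ} (hz : ‖z‖ ≤ r) : toClosedBall r D z = D z :=
    toClosedBall_eval_within D (by simpa [abs_of_pos hr0] using hz)
  rw [logCounting_eq_sum D hr0 (s := s ∪ hfin.toFinset) (by intro z hz; simp; right; simpa using hz)]
  rw [Finset.sum_congr rfl fun z hz => by rw [← hball (hs z hz)]]
  refine Finset.sum_le_sum_of_subset_of_nonneg Finset.subset_union_left fun z _ _ => ?_
  by_cases hz : ‖z‖ ≤ r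
  · rw [hball hz]
    refine mul_nonneg (by exact_mod_cast hD z) (sub_nonneg.2 ?_)
    rcases eq_or_ne z 0 with rfl | h0
    · simpa using log_nonneg hr
    · exact log_le_log (norm_pos_iff.2 h0) hz
  · rw [(toClosedBall r D).apply_eq_zero_of_notMem (by simpa [abs_of_pos hr0] using hz)]
    simp

/-- For a contracting affine map `z ↦ q z + c`, pulling back a divisor does not increase its
counting function by more than a constant. -/
theorem exists_logCounting_affine_le {D D' : locallyFinsupp ℂ ℤ} (hD : 0 ≤ D) {q c : ℂ}
    (hq : q ≠ 0) (hq1 : ‖q‖ < 1) (h : ∀ z, D' z = D (q * z + c)) :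
    ∃ C r₀ : ℝ, ∀ r ≥ r₀, Function.locallyFinsuppWithin.logCounting D' r ≤
      Function.locallyFinsuppWithin.logCounting D r + C := by
  classical
  -- From ‖z‖ ≥ ‖c‖/(1-‖q‖) on, the map does not increase the modulus, so qz+c has at least the
  -- weight of z. The finitely many points with ‖z‖ ≤ r₀ contribute the constant.
  set r₀ := max 1 (‖c‖ / (1 - ‖q‖)) with hr₀
  have hcontr {z : ℂ} {ρ : ℝ} (hρ : r₀ ≤ ρ) (hz : ‖z‖ ≤ ρ) : ‖q * z + c‖ ≤ ρ := by
    have : ‖c‖ ≤ (1 - ‖q‖) * ρ := by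
      have := (le_max_right _ _).trans hρ
      rw [div_le_iff₀ (by linarith)] at this
      linarith
    grw [norm_add_le, norm_mul, hz]
    linarith
  have hfin (r : ℝ) : (toClosedBall r D').support.Finite :=
    (toClosedBall r D').finiteSupport (isCompact_closedBall 0 |r|)
  set F : ℂ → ℝ := fun z => (D' z : ℝ) * |log ‖q * z + c‖ - log ‖z‖| with hF
  have hD' (z : ℂ) : (0 : ℝ) ≤ D' z := by rw [h]; exact_mod_cast hD _
  have hF0 (z : ℂ) : 0 ≤ F z := mul_nonneg (hD' z) (abs_nonneg _)
  refine ⟨∑ z ∈ (hfin r₀).toFinset, F z, r₀, fun r hr => ?_⟩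
  have hr1 : 1 ≤ r := (le_max_left _ _).trans hr
  have hr0 : 0 < r := by linarith
  have hinj : Function.Injective fun z : ℂ => q * z + c := fun a b hab => by
    simpa [hq] using hab
  set s := (hfin r).toFinset with hs
  have hsn : ∀ z ∈ s, ‖z‖ ≤ r := by
    intro z hz
    have h1 : z ∈ (toClosedBall r D').support := by simpa [hs] using hz
    have := Function.locallyFinsuppWithin.toClosedBall_support_subset_closedBall D' h1
    simpa [abs_of_pos hr0] using this
  have e1 : Function.locallyFinsuppWithin.logCounting D' r =
      ∑ z ∈ s, (D' z : ℝ) * (log r - log ‖z‖) := by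
    rw [logCounting_eq_sum D' hr0 (s := s) (by simp [hs])]
    refine Finset.sum_congr rfl fun z hz => ?_
    rw [toClosedBall_eval_within D' (by simpa [abs_of_pos hr0] using hsn z hz)]
  have e2 := sum_le_logCounting hD hr1 (s := s.image fun z => q * z + c) (by
    intro w hw
    obtain ⟨z, hz, rfl⟩ := Finset.mem_image.1 hw
    exact hcontr hr (hsn z hz))
  rw [Finset.sum_image fun a _ b _ hab => hinj hab] at e2
  have e3 : ∑ z ∈ s, (D' z : ℝ) * (log r - log ‖z‖) -
      ∑ z ∈ s, (D (q * z + c) : ℝ) * (log r - log ‖q * z + c‖) ≤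
      ∑ z ∈ (hfin r₀).toFinset, F z := by
    rw [← Finset.sum_sub_distrib]
    calc _ = ∑ z ∈ s, (D' z : ℝ) * (log ‖q * z + c‖ - log ‖z‖) :=
          Finset.sum_congr rfl fun z _ => by rw [h]; ring
      _ ≤ ∑ z ∈ s with ‖z‖ ≤ r₀, F z := by
          rw [Finset.sum_filter]
          refine Finset.sum_le_sum fun z _ => ?_
          split_ifs with hz
          · exact mul_le_mul_of_nonneg_left (le_abs_self _) (hD' z)
          · refine mul_nonpos_of_nonneg_of_nonpos (hD' z) (sub_nonpos.2 ?_)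
            have hz1 : r₀ ≤ ‖z‖ := (not_le.1 hz).le
            -- A point sent to the origin acquires weight log r, as `log 0 = 0`; comparison with its
            -- own weight uses ‖z‖ ≥ 1.
            rcases eq_or_ne (q * z + c) 0 with h0 | h0
            · rw [h0, norm_zero, log_zero]
              exact log_nonneg ((le_max_left _ _).trans hz1)
            · exact log_le_log (norm_pos_iff.2 h0) (hcontr hz1 le_rfl)
      _ ≤ _ := by
          refine Finset.sum_le_sum_of_subset_of_nonneg ?_ fun z _ _ => hF0 z
          intro z hz
          rw [Finset.mem_filter] at hz
          have h1 : toClosedBall r D' z ≠ 0 := by simpa [hs] using hz.1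
          rw [toClosedBall_eval_within D' (by simpa [abs_of_pos hr0] using hsn z hz.1)] at h1
          have : toClosedBall r₀ D' z ≠ 0 := by
            rwa [toClosedBall_eval_within D'
              (by simpa using hz.2.trans (le_abs_self r₀))]
          simpa using this
  linarith

/-- The number of zeros and poles in a disc, in terms of the counting functions on a larger
disc. -/
lemma sum_abs_divisor_mul_log_le {f : ℂ → ℂ} (hf : Meromorphic f) {R K : ℝ} (hR : 1 ≤ R)
    (hK : 1 ≤ K) {s : Finset ℂ} (hs : ∀ z ∈ s, ‖z‖ ≤ R) :
    (∑ u ∈ s, |(divisor f (closedBall 0 R) u : ℝ)|) * log K ≤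
      ValueDistribution.logCounting f ⊤ (K * R) + ValueDistribution.logCounting f⁻¹ ⊤ (K * R) := by
  set D := divisor f univ with hD
  have hRK : R ≤ K * R := le_mul_of_one_le_left (by linarith) hK
  have h1 := sum_le_logCounting (D := D⁺ + D⁻) (add_nonneg (posPart_nonneg D) (negPart_nonneg D))
    (hR.trans hRK) (s := s) fun z hz => (hs z hz).trans hRK
  rw [map_add, Pi.add_apply] at h1
  rw [logCounting_inv, ValueDistribution.logCounting_top, ValueDistribution.logCounting_zero,
    ← hD, add_comm (Function.locallyFinsuppWithin.logCounting D⁻ _)]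
  refine le_trans ?_ h1
  rw [Finset.sum_mul]
  refine Finset.sum_le_sum fun u hu => ?_
  have e1 : divisor f (closedBall 0 R) u = D u := by
    rw [hD, MeromorphicOn.divisor_apply (fun z _ => hf z) (by simpa using hs u hu),
      MeromorphicOn.divisor_apply (fun z _ => hf z) (mem_univ u)]
  have e2 : |(D u : ℝ)| = ((D⁺ + D⁻ : locallyFinsupp ℂ ℤ) u : ℝ) := by
    rw [Function.locallyFinsuppWithin.coe_add, Pi.add_apply,
      Function.locallyFinsuppWithin.posPart_apply, Function.locallyFinsuppWithin.negPart_apply,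
      posPart_add_negPart]
    push_cast; rfl
  rw [e1, e2, ← e2]
  -- A point with ‖u‖ ≤ R has weight log(KR) - log ‖u‖ ≥ log K in the counting function at radius
  -- KR.
  refine mul_le_mul_of_nonneg_left ?_ (abs_nonneg _)
  rw [log_mul (by linarith) (by linarith)]
  have : log ‖u‖ ≤ log R := by
    rcases eq_or_ne u 0 with rfl | h0
    · simpa using log_nonneg hR
    · exact log_le_log (norm_pos_iff.2 h0) (hs u hu)
  linarith

/-- Difference version of the lemma on the logarithmic derivative: the proximity function of
`f (q z + c) / f z` in terms of the characteristic on a larger circle. -/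
theorem proximity_shift_quotient_le_characteristic {f : ℂ → ℂ} (hf : Meromorphic f)
    (hord : ∀ z, meromorphicOrderAt f z ≠ ⊤) {q c : ℂ} (hq : q ≠ 0) (hq1 : ‖q‖ ≤ 1) {r K : ℝ}
    (hr : 1 ≤ ‖q‖ * r) (hrc : ‖c‖ ≤ r) (hK : 4 ≤ K) :
    proximity (fun z => f (q * z + c) / f z) ⊤ r ≤
      (4 * log 2 + log ((1 + ‖c‖) / ‖q‖) + 48) / log K *
        (characteristic f ⊤ (K ^ 2 * r) + characteristic f⁻¹ ⊤ (K ^ 2 * r)) := by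
  have hq' : 0 < ‖q‖ := norm_pos_iff.2 hq
  have hr0 : 0 < r := pos_of_mul_pos_right (by linarith) hq'.le
  have hr1 : 1 ≤ r := hr.trans (mul_le_of_le_one_left hr0.le hq1)
  have hK0 : 0 < K := by linarith
  -- One factor K separates r from the disc of factorisation, which makes 16r/R = 16/K; the second
  -- factor K, up to KR, divides the number of zeros and poles by log K.
  set R := K * r with hR
  have hR4 : 4 * r ≤ R := mul_le_mul_of_nonneg_right hK hr0.le
  have hR1 : 1 ≤ R := by linarith
  have hR2 : K ^ 2 * r = K * R := by rw [hR]; ring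
  have hRR : R ≤ K * R := le_mul_of_one_le_left (by linarith) (by linarith)
  have hfin := (divisor f (closedBall 0 R)).finiteSupport (isCompact_closedBall 0 R)
  set s := hfin.toFinset with hs
  have hsn : ∀ z ∈ s, ‖z‖ ≤ R := by
    intro z hz
    have h1 : z ∈ (divisor f (closedBall 0 R)).support := by simpa [hs] using hz
    simpa using (divisor f (closedBall 0 R)).supportWithinDomain h1
  have b1 := proximity_shift_quotient_le hf hord hq hq1 hr hrc hR4 (s := s) (by simp [hs])
  have b2 := sum_abs_divisor_mul_log_le hf hR1 (show 1 ≤ K by linarith) hsn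
  set n := ∑ u ∈ s, |(divisor f (closedBall 0 R) u : ℝ)| with hn
  rw [hR2]
  set S := characteristic f ⊤ (K * R) + characteristic f⁻¹ ⊤ (K * R) with hS
  have p0 := proximity_nonneg (f := f) (a := ⊤) (K * R)
  have p1 := proximity_nonneg (f := f⁻¹) (a := ⊤) (K * R)
  simp only [Pi.zero_apply] at p0 p1
  have c1 : n * log K ≤ S := by
    simp only [hS, characteristic, Pi.add_apply]
    linarith
  have c2 : proximity f ⊤ R + proximity f⁻¹ ⊤ R ≤ S := by
    have m1 := characteristic_monotoneOn hf (show R ∈ Ioi 0 by simp; linarith)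
      (show K * R ∈ Ioi 0 by simp; positivity) hRR
    have m2 := characteristic_monotoneOn hf.inv (show R ∈ Ioi 0 by simp; linarith)
      (show K * R ∈ Ioi 0 by simp; positivity) hRR
    have n1 := ValueDistribution.logCounting_nonneg (f := f) (e := ⊤) hR1
    have n2 := ValueDistribution.logCounting_nonneg (f := f⁻¹) (e := ⊤) hR1
    simp only [hS]
    simp only [characteristic, Pi.add_apply] at m1 m2 ⊢
    linarith
  have hlogK : 1 ≤ log K := by
    rw [le_log_iff_exp_le hK0]
    linarith [exp_one_lt_d9]
  have hlogK0 : 0 < log K := by linarith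
  have c3 : n ≤ S / log K := by rwa [le_div_iff₀ hlogK0]
  have hn0 : 0 ≤ n := Finset.sum_nonneg fun u _ => abs_nonneg _
  have hS0 : 0 ≤ S := (mul_nonneg hn0 hlogK0.le).trans c1
  have hc := norm_nonneg c
  have hlog : 0 ≤ log ((1 + ‖c‖) / ‖q‖) := by
    apply log_nonneg
    rw [le_div_iff₀ hq']; linarith
  have hlog2 : log 2 ≤ 1 := by linarith [log_two_lt_d9]
  have hlog20 : 0 ≤ log 2 := log_nonneg one_le_two
  have c4 : n ≤ S := by nlinarith
  have c5 : 16 * r / R ≤ 16 / log K := by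
    rw [hR, mul_div_mul_right _ _ hr0.ne']
    exact div_le_div_of_nonneg_left (by norm_num) hlogK0
      (by linarith [log_le_sub_one_of_pos hK0])
  -- The constant 48 is 16 · (1 + 2): the proximity functions cost S, and the n · 2 log 2 term at
  -- most 2S, by n ≤ S and log 2 ≤ 1.
  calc _ ≤ _ := b1
    _ ≤ S / log K * (4 * log 2 + log ((1 + ‖c‖) / ‖q‖)) + 16 / log K * (S + S * 2) := by
        refine add_le_add (mul_le_mul_of_nonneg_right c3 (by positivity))
          (mul_le_mul c5 (add_le_add c2 ?_) ?_ (by positivity))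
        · nlinarith
        · exact add_nonneg (add_nonneg (proximity_nonneg (f := f) (a := ⊤) R)
            (proximity_nonneg (f := f⁻¹) (a := ⊤) R)) (by positivity)
    _ = _ := by ring

end HahnNevanlinna

/-! ### Orders of g, of its shift and of the Hahn difference. -/

namespace HahnNevanlinna

open MeasureTheory Set Real Metric ValueDistribution MeromorphicOn
open Function (locallyFinsupp)

lemma meromorphic_sub_const {g : ℂ → ℂ} (hg : Meromorphic g) (a : ℂ) :
    Meromorphic fun z => g z - a :=
  fun z => (hg z).sub (MeromorphicAt.const a z)

/-- Identity theorem: infinite order at one point spreads over the whole plane and would make g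
constant. -/
lemma meromorphicOrderAt_sub_const_ne_top {g : ℂ → ℂ} (hg : Meromorphic g)
    (hconst : ¬ IsConstMeromorphic g) (a z : ℂ) :
    meromorphicOrderAt (fun z => g z - a) z ≠ ⊤ := by
  intro htop
  have hm := meromorphic_sub_const hg a
  have hall : ∀ u, meromorphicOrderAt (fun z => g z - a) u = ⊤ := by
    by_contra! h
    exact hm.exists_meromorphicOrderAt_ne_top_iff_forall.1 h z htop
  refine hconst ⟨a, ?_⟩
  change {x | g x = a} ∈ codiscrete ℂ
  simp only [codiscrete, mem_codiscreteWithin_iff_forall_mem_nhdsNE]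
  intro x _
  filter_upwards [meromorphicOrderAt_eq_top_iff.1 (hall x)] with w hw
  left
  exact sub_eq_zero.1 hw

lemma meromorphicOrderAt_ne_top_of_not_const {g : ℂ → ℂ} (hg : Meromorphic g)
    (hconst : ¬ IsConstMeromorphic g) (z : ℂ) : meromorphicOrderAt g z ≠ ⊤ := by
  simpa using meromorphicOrderAt_sub_const_ne_top hg hconst 0 z

lemma meromorphic_comp_affine {g : ℂ → ℂ} (hg : Meromorphic g) (q c : ℂ) :
    Meromorphic fun z => g (q * z + c) := fun z =>
  (hg (q * z + c)).comp_analyticAt (f := g) (g := fun z => q * z + c) (by fun_prop)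

lemma meromorphicOrderAt_comp_affine (g : ℂ → ℂ) {q : ℂ} (hq : q ≠ 0) (c z : ℂ) :
    meromorphicOrderAt (fun z => g (q * z + c)) z = meromorphicOrderAt g (q * z + c) := by
  have h1 : HasDerivAt (fun z => q * z + c) q z := by
    simpa using ((hasDerivAt_id z).const_mul q).add_const c
  exact meromorphicOrderAt_comp_of_deriv_ne_zero (f := g) (g := fun z => q * z + c)
    (by fun_prop) (by rw [h1.deriv]; exact hq)

lemma affine_fixedPoint {q : ℂ} (hq1 : q ≠ 1) (c : ℂ) : q * (c / (1 - q)) + c = c / (1 - q) := by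
  have : 1 - q ≠ 0 := sub_ne_zero.2 hq1.symm
  field_simp
  ring

/-- A meromorphic function invariant under a contracting affine map is constant. -/
theorem meromorphicOrderAt_shift_sub_ne_top {g : ℂ → ℂ} (hg : Meromorphic g)
    (hconst : ¬ IsConstMeromorphic g) {q : ℂ} (hq : q ≠ 0) (hq1 : ‖q‖ < 1) (c z : ℂ) :
    meromorphicOrderAt (fun z => g (q * z + c) - g z) z ≠ ⊤ := by
  have hm : Meromorphic fun z => g (q * z + c) - g z := (meromorphic_comp_affine hg q c).sub hg
  refine hm.exists_meromorphicOrderAt_ne_top_iff_forall.1 ?_ z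
  have hq1' : q ≠ 1 := by rintro rfl; simp at hq1
  -- The fixed point of the contraction. Invariance near it makes g constant along each orbit z₀ +
  -- q^k (w - z₀), which converges to z₀.
  set z₀ := c / (1 - q) with hz₀
  have hfix : q * z₀ + c = z₀ := affine_fixedPoint hq1' c
  refine ⟨z₀, fun htop => ?_⟩
  have hinv := meromorphicOrderAt_eq_top_iff.1 htop
  rw [eventually_nhdsWithin_iff, Metric.eventually_nhds_iff] at hinv
  obtain ⟨ε, hε, hinv⟩ := hinv
  have hiter (w : ℂ) (k : ℕ) : (fun z => q * z + c)^[k] w = z₀ + q ^ k * (w - z₀) := by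
    induction k with
    | zero => simp
    | succ k ih =>
      rw [Function.iterate_succ_apply', ih]
      linear_combination hfix
  have hgit (w : ℂ) (hw : w ≠ z₀) (hwε : dist w z₀ < ε) (k : ℕ) :
      g (z₀ + q ^ k * (w - z₀)) = g w := by
    induction k with
    | zero => simp
    | succ k ih =>
      rw [← ih]
      have hne : z₀ + q ^ k * (w - z₀) ≠ z₀ := by
        simp [hq, sub_ne_zero.2 hw]
      have hd : dist (z₀ + q ^ k * (w - z₀)) z₀ < ε := by
        rw [dist_eq_norm, add_sub_cancel_left, norm_mul, norm_pow, ← dist_eq_norm]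
        exact (mul_le_of_le_one_left dist_nonneg (pow_le_one₀ (norm_nonneg q) hq1.le)).trans_lt hwε
      have := sub_eq_zero.1 (hinv hd hne)
      rw [← this]
      congr 1
      linear_combination -hfix
  have hlim (w : ℂ) (hw : w ≠ z₀) :
      Tendsto (fun k : ℕ => z₀ + q ^ k * (w - z₀)) atTop (𝓝[≠] z₀) := by
    rw [tendsto_nhdsWithin_iff]
    constructor
    · simpa using ((tendsto_pow_atTop_nhds_zero_of_norm_lt_one hq1).mul_const (w - z₀)).const_add z₀
    · exact Eventually.of_forall fun k => by simp [hq, sub_ne_zero.2 hw]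
  have hpt : ∀ᶠ w in 𝓝[≠] z₀, ∀ k : ℕ, g (z₀ + q ^ k * (w - z₀)) = g w := by
    rw [eventually_nhdsWithin_iff, Metric.eventually_nhds_iff]
    exact ⟨ε, hε, fun w hw hne => hgit w hne hw⟩
  -- A pole at z₀ would force the constant g(w) to be unbounded along the orbit; otherwise g has a
  -- limit b at z₀, so g = b near z₀, against non-constancy.
  rcases lt_or_ge (meromorphicOrderAt g z₀) 0 with ho | ho
  · have hcob := tendsto_cobounded_of_meromorphicOrderAt_neg ho
    obtain ⟨w, hw, hwne⟩ := (hpt.and self_mem_nhdsWithin).exists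
    have h1 := hcob.comp (hlim w hwne)
    have h2 : (g ∘ fun k : ℕ => z₀ + q ^ k * (w - z₀)) = fun _ => g w := funext fun k => hw k
    rw [h2] at h1
    exact (Metric.disjoint_nhds_cobounded (g w)).le_bot.not_gt
      (lt_of_lt_of_le (bot_lt_iff_ne_bot.2 (map_neBot (f := (atTop : Filter ℕ)) (m := fun _ => g w)).ne)
        (le_inf tendsto_const_nhds h1))
  · obtain ⟨b, hb⟩ := tendsto_nhds_of_meromorphicOrderAt_nonneg (hg z₀) ho
    refine meromorphicOrderAt_sub_const_ne_top hg hconst b z₀ (meromorphicOrderAt_eq_top_iff.2 ?_)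
    filter_upwards [hpt, self_mem_nhdsWithin] with w hw hwne
    have h1 := hb.comp (hlim w hwne)
    have h2 : (g ∘ fun k : ℕ => z₀ + q ^ k * (w - z₀)) = fun _ => g w := funext fun k => hw k
    rw [h2] at h1
    exact sub_eq_zero.2 (tendsto_nhds_unique tendsto_const_nhds h1)

lemma meromorphic_hahnDiff {g : ℂ → ℂ} (hg : Meromorphic g) (q c : ℂ) :
    Meromorphic (hahnDiff q c g) := fun z =>
  ((meromorphic_comp_affine hg q c z).sub (hg z)).div
    (by fun_prop : MeromorphicAt (fun z => (q - 1) * z + c) z)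

lemma meromorphicOrderAt_linear_of_ne {q c z : ℂ} (h : (q - 1) * z + c ≠ 0) :
    meromorphicOrderAt (fun z => (q - 1) * z + c) z = 0 := by
  rw [← tendsto_ne_zero_iff_meromorphicOrderAt_eq_zero (by fun_prop)]
  refine ⟨_, h, ?_⟩
  have : ContinuousAt (fun z => (q - 1) * z + c) z := by fun_prop
  exact this.tendsto.mono_left nhdsWithin_le_nhds

lemma meromorphicOrderAt_linear_of_eq {q c z : ℂ} (hq : q ≠ 1) (h : (q - 1) * z + c = 0) :
    meromorphicOrderAt (fun z => (q - 1) * z + c) z = 1 := by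
  have : (fun w => (q - 1) * w + c) = fun w => (q - 1) * (w - z) := by
    ext w; linear_combination h
  rw [this, show (1 : WithTop ℤ) = ((1 : ℤ) : WithTop ℤ) from rfl,
    meromorphicOrderAt_eq_int_iff (by fun_prop)]
  refine ⟨fun _ => q - 1, analyticAt_const, sub_ne_zero.2 hq, Eventually.of_forall fun w => ?_⟩
  rw [zpow_one, smul_eq_mul, mul_comm]

lemma meromorphicOrderAt_hahnDiff {g : ℂ → ℂ} (hg : Meromorphic g) (q c z : ℂ) :
    meromorphicOrderAt (hahnDiff q c g) z =
      meromorphicOrderAt (fun z => g (q * z + c) - g z) z -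
        meromorphicOrderAt (fun z => (q - 1) * z + c) z :=
  fun_meromorphicOrderAt_div ((meromorphic_comp_affine hg q c z).sub (hg z)) (by fun_prop)

lemma meromorphicOrderAt_hahnDiff_ne_top {g : ℂ → ℂ} (hg : Meromorphic g)
    (hconst : ¬ IsConstMeromorphic g) {q : ℂ} (hq : q ≠ 0) (hq1 : ‖q‖ < 1) (c z : ℂ) :
    meromorphicOrderAt (hahnDiff q c g) z ≠ ⊤ := by
  have hq1' : q ≠ 1 := by rintro rfl; simp at hq1
  have h1 := meromorphicOrderAt_shift_sub_ne_top hg hconst hq hq1 c z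
  rw [meromorphicOrderAt_hahnDiff hg]
  lift meromorphicOrderAt (fun z => g (q * z + c) - g z) z to ℤ using h1 with e
  by_cases h : (q - 1) * z + c = 0
  · rw [meromorphicOrderAt_linear_of_eq hq1' h]
    exact WithTop.coe_ne_top (a := e - 1)
  · rw [meromorphicOrderAt_linear_of_ne h]
    simp

/-- Order of the Hahn difference of the reciprocal. -/
lemma meromorphicOrderAt_hahnDiff_inv {g : ℂ → ℂ} (hg : Meromorphic g)
    (hconst : ¬ IsConstMeromorphic g) {q : ℂ} (hq : q ≠ 0) (c z : ℂ) :
    meromorphicOrderAt (hahnDiff q c g⁻¹) z = meromorphicOrderAt (hahnDiff q c g) z -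
      meromorphicOrderAt g z - meromorphicOrderAt g (q * z + c) := by
  have hgq := meromorphic_comp_affine hg q c
  -- The quotient rule D(1/g)(z) = -Dg(z) / (g(z) g(qz+c)), valid where neither factor vanishes.
  have h1 : hahnDiff q c g⁻¹ =ᶠ[𝓝[≠] z]
      fun z => -((hahnDiff q c g / g) z / g (q * z + c)) := by
    have n1 := (meromorphicOrderAt_ne_top_iff_eventually_ne_zero (hg z)).1
      (meromorphicOrderAt_ne_top_of_not_const hg hconst z)
    have n2 := (meromorphicOrderAt_ne_top_iff_eventually_ne_zero (hgq z)).1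
      (by rw [meromorphicOrderAt_comp_affine g hq]
          exact meromorphicOrderAt_ne_top_of_not_const hg hconst _)
    filter_upwards [n1, n2] with w h1 h2
    simp only [hahnDiff, Pi.inv_apply, Pi.div_apply]
    rw [inv_sub_inv h2 h1]
    field_simp
    ring
  rw [meromorphicOrderAt_congr h1, ← meromorphicOrderAt_fun_neg,
    fun_meromorphicOrderAt_div ((meromorphic_hahnDiff hg q c z).div (hg z)) (hgq z),
    meromorphicOrderAt_div (meromorphic_hahnDiff hg q c z) (hg z),
    meromorphicOrderAt_comp_affine g hq]

/-- Lower bounds for the order of the Hahn difference. -/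
lemma hahnDiff_order_bounds {g : ℂ → ℂ} (hg : Meromorphic g) {q : ℂ} (hq : q ≠ 0)
    (hq1 : ‖q‖ < 1) (c z : ℂ) {n o d : ℤ} (hn : meromorphicOrderAt g z = n)
    (ho : meromorphicOrderAt g (q * z + c) = o)
    (hd : meromorphicOrderAt (hahnDiff q c g) z = d) :
    (0 ≤ n → -max (-o) 0 ≤ d) ∧ (n < 0 → 0 ≤ -n + max (-o) 0 + d) := by
  have hq1' : q ≠ 1 := by rintro rfl; simp at hq1
  have hgq := meromorphic_comp_affine hg q c
  have hmin := meromorphicOrderAt_add (hgq z) (hg z).neg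
  rw [← meromorphicOrderAt_neg, meromorphicOrderAt_comp_affine g hq, hn, ho,
    ← sub_eq_add_neg] at hmin
  change _ ≤ meromorphicOrderAt (fun z => g (q * z + c) - g z) z at hmin
  rw [meromorphicOrderAt_hahnDiff hg] at hd
  -- The denominator vanishes only at the fixed point, where it costs one order and where o = n. If
  -- g is finite there, the numerator vanishes too and makes up for the loss; if g has a pole, the
  -- slack -n ≥ 1 does.
  by_cases h : (q - 1) * z + c = 0
  · rw [meromorphicOrderAt_linear_of_eq hq1' h] at hd
    have hz : q * z + c = z := by linear_combination h
    have hon : o = n := by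
      rw [hz, hn] at ho; exact_mod_cast ho.symm
    obtain ⟨e, he⟩ : ∃ e : ℤ, meromorphicOrderAt (fun z => g (q * z + c) - g z) z = e := by
      generalize meromorphicOrderAt (fun z => g (q * z + c) - g z) z = x at hd
      cases x with
      | top => simp at hd
      | coe e => exact ⟨e, rfl⟩
    rw [he] at hd hmin
    have hde : d = e - 1 := by
      have : ((e - 1 : ℤ) : WithTop ℤ) = d := hd
      exact_mod_cast this.symm
    have hmin' : min o n ≤ e := by exact_mod_cast hmin
    subst hon hde
    refine ⟨fun hn0 => ?_, fun hn0 => by omega⟩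
    obtain ⟨b, hb⟩ := tendsto_nhds_of_meromorphicOrderAt_nonneg (hg z)
      (by rw [hn]; exact_mod_cast hn0)
    obtain ⟨b', hb'⟩ := tendsto_nhds_of_meromorphicOrderAt_nonneg (hgq z)
      (by rw [meromorphicOrderAt_comp_affine g hq, ho]; exact_mod_cast hn0)
    have hσ : Tendsto (fun z => q * z + c) (𝓝[≠] z) (𝓝[≠] z) := by
      rw [tendsto_nhdsWithin_iff]
      constructor
      · have : ContinuousAt (fun z => q * z + c) z := by fun_prop
        have h2 := this.tendsto
        rw [hz] at h2
        exact h2.mono_left nhdsWithin_le_nhds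
      · filter_upwards [self_mem_nhdsWithin] with w hw hw'
        apply hw
        have hw'' : q * w + c = z := hw'
        have : q * (w - z) = 0 := by linear_combination hw'' - hz
        simpa [hq, sub_eq_zero] using this
    have hbb : b' = b := tendsto_nhds_unique hb' (hb.comp hσ)
    have hpos : 0 < meromorphicOrderAt (fun z => g (q * z + c) - g z) z := by
      refine (tendsto_zero_iff_meromorphicOrderAt_pos ((hgq z).sub (hg z))).1 ?_
      have := hb'.sub hb
      rwa [hbb, sub_self] at this
    rw [he] at hpos
    have : 0 < e := by exact_mod_cast hpos
    omega
  · rw [meromorphicOrderAt_linear_of_ne h] at hd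
    have : meromorphicOrderAt (fun z => g (q * z + c) - g z) z = d := by simpa using hd
    rw [this] at hmin
    have hmin' : min o n ≤ d := by exact_mod_cast hmin
    constructor <;> intro <;> omega

end HahnNevanlinna

/-! ### The second inequality: a local comparison of multiplicities. -/

namespace HahnNevanlinna

open MeasureTheory Set Real Metric ValueDistribution MeromorphicOn
open Function (locallyFinsupp)
open Function.locallyFinsuppWithin (posPart_apply negPart_apply)

/-- The divisor of the `a`-points of `g`, with multiplicity. -/
noncomputable def valueDivisor (g : ℂ → ℂ) : WithTop ℂ → locallyFinsupp ℂ ℤ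
  | ⊤ => (divisor g univ)⁻
  | (a : ℂ) => (divisor (fun z => g z - a) univ)⁺

lemma nevNAt_eq_logCounting_valueDivisor (g : ℂ → ℂ) (a : WithTop ℂ) (r : ℝ) :
    nevNAt g a r = Function.locallyFinsuppWithin.logCounting (valueDivisor g a) r := by
  cases a with
  | top => simp [nevNAt, valueDivisor, ValueDistribution.logCounting_top]
  | coe a => simp [nevNAt, valueDivisor, ValueDistribution.logCounting_coe]

lemma divisor_univ_apply {f : ℂ → ℂ} (hf : Meromorphic f) (z : ℂ) :
    divisor f univ z = (meromorphicOrderAt f z).untop₀ :=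
  MeromorphicOn.divisor_apply (fun z _ => hf z) (mem_univ z)

lemma meromorphicOrderAt_eq_divisor_univ {f : ℂ → ℂ} (hf : Meromorphic f) {z : ℂ}
    (h : meromorphicOrderAt f z ≠ ⊤) : meromorphicOrderAt f z = divisor f univ z := by
  rw [divisor_univ_apply hf, WithTop.coe_untop₀_of_ne_top h]

lemma valueDivisor_nonneg (g : ℂ → ℂ) (a : WithTop ℂ) (z : ℂ) : 0 ≤ valueDivisor g a z := by
  cases a with
  | top => simp only [valueDivisor, negPart_apply]; exact negPart_nonneg _
  | coe a => simp only [valueDivisor, posPart_apply]; exact posPart_nonneg _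

lemma tendsto_nhds_of_valueDivisor_ne_zero {g : ℂ → ℂ} (hg : Meromorphic g) {a z : ℂ}
    (h : valueDivisor g a z ≠ 0) : Tendsto g (𝓝[≠] z) (𝓝 a) := by
  have hm := meromorphic_sub_const hg a
  have hpos : 0 < divisor (fun z => g z - a) univ z := by
    by_contra! hle
    exact h (by simp only [valueDivisor, posPart_apply]; exact posPart_eq_zero.2 hle)
  rw [divisor_univ_apply hm] at hpos
  have h2 : 0 < meromorphicOrderAt (fun z => g z - a) z := by
    generalize meromorphicOrderAt (fun z => g z - a) z = x at hpos
    cases x with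
    | top => simp at hpos
    | coe e => exact_mod_cast hpos
  have := (tendsto_zero_of_meromorphicOrderAt_pos h2).add_const a
  simpa using this

lemma tendsto_cobounded_of_valueDivisor_top_ne_zero {g : ℂ → ℂ} (hg : Meromorphic g) {z : ℂ}
    (h : valueDivisor g ⊤ z ≠ 0) : Tendsto g (𝓝[≠] z) (Bornology.cobounded ℂ) := by
  have hneg : divisor g univ z < 0 := by
    by_contra! hle
    exact h (by simp only [valueDivisor, negPart_apply]; exact negPart_eq_zero.2 hle)
  rw [divisor_univ_apply hg] at hneg
  apply tendsto_cobounded_of_meromorphicOrderAt_neg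
  generalize meromorphicOrderAt g z = x at hneg
  cases x with
  | top => simp at hneg
  | coe e => exact_mod_cast hneg

lemma not_tendsto_nhds_of_tendsto_cobounded {g : ℂ → ℂ} {a z : ℂ}
    (h : Tendsto g (𝓝[≠] z) (Bornology.cobounded ℂ)) : ¬ Tendsto g (𝓝[≠] z) (𝓝 a) :=
  fun h' => h'.not_tendsto (Metric.disjoint_nhds_cobounded a) h

/-- The limit of g at z in the extended plane is unique. Hence at each point at most one target
contributes to the sum over the a_i. -/
lemma eq_of_valueDivisor_ne_zero {g : ℂ → ℂ} (hg : Meromorphic g) {a b : WithTop ℂ} {z : ℂ}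
    (ha : valueDivisor g a z ≠ 0) (hb : valueDivisor g b z ≠ 0) : a = b := by
  cases a with
  | top =>
    cases b with
    | top => rfl
    | coe b =>
      exact absurd (tendsto_nhds_of_valueDivisor_ne_zero hg hb)
        (not_tendsto_nhds_of_tendsto_cobounded (tendsto_cobounded_of_valueDivisor_top_ne_zero hg ha))
  | coe a =>
    cases b with
    | top =>
      exact absurd (tendsto_nhds_of_valueDivisor_ne_zero hg ha)
        (not_tendsto_nhds_of_tendsto_cobounded (tendsto_cobounded_of_valueDivisor_top_ne_zero hg hb))
    | coe b =>
      exact congrArg _ (tendsto_nhds_unique (tendsto_nhds_of_valueDivisor_ne_zero hg ha)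
        (tendsto_nhds_of_valueDivisor_ne_zero hg hb))

lemma hahnDivisor_nonneg (q c : ℂ) (g : ℂ → ℂ) (a : WithTop ℂ) (z : ℂ) :
    0 ≤ hahnDivisor q c g a z := by
  cases a with
  | top => exact sub_nonneg.2 (min_le_left _ _)
  | coe a => exact sub_nonneg.2 (min_le_left _ _)

/-- The multiplicities removed in passing from the counting function of `g = a` to its Hahn type
version are controlled by the order of the Hahn difference and the poles of `g` and its shift. -/
lemma valueDivisor_sub_hahnDivisor_le {g : ℂ → ℂ} (hg : Meromorphic g)
    (hconst : ¬ IsConstMeromorphic g) {q : ℂ} (hq : q ≠ 0) (hq1 : ‖q‖ < 1) (c : ℂ)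
    (a : WithTop ℂ) (z : ℂ) :
    0 ≤ (divisor g univ z)⁻ + (divisor g univ (q * z + c))⁻ + divisor (hahnDiff q c g) univ z ∧
    valueDivisor g a z - hahnDivisor q c g a z ≤
      (divisor g univ z)⁻ + (divisor g univ (q * z + c))⁻ + divisor (hahnDiff q c g) univ z := by
  have hn := meromorphicOrderAt_eq_divisor_univ hg (meromorphicOrderAt_ne_top_of_not_const hg hconst z)
  have ho := meromorphicOrderAt_eq_divisor_univ hg
    (meromorphicOrderAt_ne_top_of_not_const hg hconst (q * z + c))
  have hd := meromorphicOrderAt_eq_divisor_univ (meromorphic_hahnDiff hg q c)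
    (meromorphicOrderAt_hahnDiff_ne_top hg hconst hq hq1 c z)
  have hb := hahnDiff_order_bounds hg hq hq1 c z hn ho hd
  have hinv := meromorphicOrderAt_hahnDiff_inv hg hconst hq c z
  rw [hn, ho, hd] at hinv
  have hdi : divisor (hahnDiff q c g⁻¹) univ z =
      divisor (hahnDiff q c g) univ z - divisor g univ z - divisor g univ (q * z + c) := by
    rw [divisor_univ_apply (meromorphic_hahnDiff hg.inv q c), hinv]
    rfl
  have hX : 0 ≤ (divisor g univ z)⁻ + (divisor g univ (q * z + c))⁻ +
      divisor (hahnDiff q c g) univ z := by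
    simp only [negPart_def]
    omega
  refine ⟨hX, ?_⟩
  by_cases h0 : valueDivisor g a z = 0
  · have := hahnDivisor_nonneg q c g a z
    omega
  cases a with
  | top =>
    simp only [hahnDivisor, valueDivisor, Function.locallyFinsuppWithin.coe_sub, Pi.sub_apply,
      Function.locallyFinsuppWithin.min_apply, posPart_apply, negPart_apply, hdi]
    -- At a pole the order of D(1/g) is d - n - o, and -n = n⁻ while -o ≤ o⁻; the positive part is
    -- harmless because the bound itself is nonnegative.
    simp only [negPart_def, posPart_def] at *
    omega
  | coe a =>
    have hlim := tendsto_nhds_of_valueDivisor_ne_zero hg h0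
    have hn0 : 0 ≤ divisor g univ z := by
      have := (tendsto_nhds_iff_meromorphicOrderAt_nonneg (hg z)).1 ⟨a, hlim⟩
      rw [hn] at this
      exact_mod_cast this
    simp only [hahnDivisor, valueDivisor, Function.locallyFinsuppWithin.coe_sub, Pi.sub_apply,
      Function.locallyFinsuppWithin.min_apply, posPart_apply]
    -- At a finite value n⁻ = 0, and the bound o⁻ + d dominates both d and 0, hence d⁺.
    simp only [negPart_def, posPart_def] at *
    omega

/-- The second inequality of the main theorem, with a bounded error term. -/
theorem exists_sum_nevNAt_sub_hahnRamification_le {g : ℂ → ℂ} (hg : Meromorphic g)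
    (hconst : ¬ IsConstMeromorphic g) {q : ℂ} (hq : q ≠ 0) (hq1 : ‖q‖ < 1) (c : ℂ)
    {l : ℕ} {a : Fin l → WithTop ℂ} (ha : Function.Injective a) :
    ∃ C r₀ : ℝ, ∀ r ≥ r₀, (∑ i, nevNAt g (a i) r) - hahnRamification q c g r ≤
      (∑ i, hahnN q c g (a i) r) + C := by
  have hgq := meromorphic_comp_affine hg q c
  set P := (divisor g univ)⁻ with hP
  set P' := (divisor (fun z => g (q * z + c)) univ)⁻ with hP'
  set Δ := divisor (hahnDiff q c g) univ with hΔ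
  have hPP' (z : ℂ) : P' z = P (q * z + c) := by
    rw [hP, hP', negPart_apply, negPart_apply, divisor_univ_apply hgq, divisor_univ_apply hg,
      meromorphicOrderAt_comp_affine g hq]
  -- The poles of the shift are exchanged for a second copy of N(r, g) at the cost of a constant.
  obtain ⟨C, r₀, hC⟩ := exists_logCounting_affine_le (negPart_nonneg _) hq hq1 hPP'
  refine ⟨C, max 1 r₀, fun r hr => ?_⟩
  have hr1 : 1 ≤ r := (le_max_left _ _).trans hr
  have hCr := hC r ((le_max_right _ _).trans hr)
  have hle : ∑ i, (valueDivisor g (a i) - hahnDivisor q c g (a i)) ≤ P + P' + Δ := by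
    intro z
    have key (i : Fin l) := valueDivisor_sub_hahnDivisor_le hg hconst hq hq1 c (a i) z
    have hz : P z + P' z + Δ z = (divisor g univ z)⁻ + (divisor g univ (q * z + c))⁻ +
        divisor (hahnDiff q c g) univ z := by
      rw [hPP', hP, negPart_apply, negPart_apply]
    rw [Function.locallyFinsuppWithin.coe_sum, Finset.sum_apply]
    simp only [Function.locallyFinsuppWithin.coe_add, Function.locallyFinsuppWithin.coe_sub,
      Pi.add_apply, Pi.sub_apply]
    rw [hz]
    by_cases hex : ∃ i, valueDivisor g (a i) z ≠ 0
    · obtain ⟨i, hi⟩ := hex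
      rw [← Finset.add_sum_erase _ _ (Finset.mem_univ i)]
      refine (add_le_of_nonpos_right (Finset.sum_nonpos fun j hj => ?_)).trans (key i).2
      have h0 : valueDivisor g (a j) z = 0 := by
        by_contra hne
        exact (Finset.mem_erase.1 hj).1 (ha (eq_of_valueDivisor_ne_zero hg hne hi))
      rw [h0]
      linarith [hahnDivisor_nonneg q c g (a j) z]
    · push Not at hex
      refine (Finset.sum_nonpos fun i _ => ?_).trans
        (valueDivisor_sub_hahnDivisor_le hg hconst hq hq1 c ⊤ z).1
      rw [hex i]
      linarith [hahnDivisor_nonneg q c g (a i) z]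
  have h1 := Function.locallyFinsuppWithin.logCounting_le hle hr1
  simp only [map_sum, map_sub, map_add, Finset.sum_apply, Pi.sub_apply, Pi.add_apply,
    Finset.sum_sub_distrib] at h1
  rw [hΔ, log_counting_zero_sub_logCounting_top, Pi.sub_apply] at h1
  simp only [nevNAt_eq_logCounting_valueDivisor, hahnN, hahnRamification, nevN]
  rw [logCounting_inv, ValueDistribution.logCounting_top (f := g)]
  linarith

end HahnNevanlinna

/-! ### Proximity functions of D/(g-b) and of 1/(g-b). -/

namespace HahnNevanlinna

open MeasureTheory Set Real Metric ValueDistribution MeromorphicOn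
open Function (locallyFinsupp)

/-- A point can be close to at most one of finitely many distinct points. -/
lemma exists_sum_posLog_norm_inv_le {ι : Type*} (s : Finset ι) {b : ι → ℂ} (hb : InjOn b s) :
    ∃ C, ∀ w d : ℂ, d ≠ 0 → ∑ i ∈ s, log⁺ ‖w - b i‖⁻¹ ≤
      log⁺ ‖d‖⁻¹ + ∑ i ∈ s, log⁺ ‖d / (w - b i)‖ + C := by
  classical
  -- δ separates the points, so w lies within δ/2 of at most one b j. The others contribute at most
  -- log⁺(2/δ) each, and for b j one writes 1/(w-b j) = (1/d) · d/(w-b j).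
  obtain ⟨δ, hδ, hδ0⟩ : ∃ δ : ℝ, (∀ p ∈ s.offDiag, δ ≤ ‖b p.1 - b p.2‖) ∧ 0 < δ := by
    have h1 : ∀ᶠ δ in 𝓝[>] (0 : ℝ), ∀ p ∈ s.offDiag, δ ≤ ‖b p.1 - b p.2‖ := by
      rw [eventually_all_finset]
      intro p hp
      rw [Finset.mem_offDiag] at hp
      have : 0 < ‖b p.1 - b p.2‖ :=
        norm_pos_iff.2 (sub_ne_zero.2 fun h => hp.2.2 (hb hp.1 hp.2.1 h))
      exact (eventually_nhdsWithin_of_eventually_nhds (eventually_lt_nhds this)).mono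
        fun _ h => h.le
    exact (h1.and self_mem_nhdsWithin).exists
  have hfar {x : ℂ} (hx : δ / 2 ≤ ‖x‖) : log⁺ ‖x‖⁻¹ ≤ log⁺ (2 / δ) := by
    refine posLog_le_posLog (by positivity) ?_
    rw [inv_le_comm₀ (by linarith) (by positivity), inv_div]
    exact hx
  refine ⟨∑ i ∈ s, log⁺ (2 / δ), fun w d hd => ?_⟩
  have hnn : 0 ≤ ∑ i ∈ s, log⁺ ‖d / (w - b i)‖ := Finset.sum_nonneg fun i _ => posLog_nonneg
  by_cases hex : ∃ j ∈ s, ‖w - b j‖ < δ / 2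
  · obtain ⟨j, hj, hjw⟩ := hex
    have h1 : ∑ i ∈ s.erase j, log⁺ ‖w - b i‖⁻¹ ≤ ∑ i ∈ s, log⁺ (2 / δ) := by
      refine (Finset.sum_le_sum fun i hi => hfar ?_).trans
        (Finset.sum_le_sum_of_subset_of_nonneg (Finset.erase_subset j s) fun _ _ _ => posLog_nonneg)
      have h2 := hδ (j, i) (Finset.mem_offDiag.2 ⟨hj, Finset.mem_of_mem_erase hi,
        (Finset.ne_of_mem_erase hi).symm⟩)
      have h3 : ‖b j - b i‖ ≤ ‖w - b i‖ + ‖w - b j‖ := by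
        rw [← norm_sub_rev (b j) w]
        have := norm_add_le (b j - w) (w - b i)
        rw [sub_add_sub_cancel] at this
        linarith
      simp only at h2
      linarith
    have h2 : log⁺ ‖w - b j‖⁻¹ ≤ log⁺ ‖d‖⁻¹ + log⁺ ‖d / (w - b j)‖ := by
      have : ‖w - b j‖⁻¹ = ‖d‖⁻¹ * ‖d / (w - b j)‖ := by
        rw [norm_div, div_eq_mul_inv, inv_mul_cancel_left₀ (norm_ne_zero_iff.2 hd)]
      rw [this]
      exact posLog_mul
    have h3 : log⁺ ‖d / (w - b j)‖ ≤ ∑ i ∈ s, log⁺ ‖d / (w - b i)‖ :=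
      Finset.single_le_sum (f := fun i => log⁺ ‖d / (w - b i)‖) (fun i _ => posLog_nonneg) hj
    rw [← Finset.add_sum_erase _ _ hj]
    linarith
  · push Not at hex
    have h1 := Finset.sum_le_sum fun i hi => hfar (hex i hi)
    have := posLog_nonneg (x := ‖d‖⁻¹)
    linarith

/-- Circle mean of `exists_sum_posLog_norm_inv_le`: all the finite targets together cost a single
m(r, 1/D). -/
lemma exists_sum_proximity_inv_le {g D : ℂ → ℂ} (hg : Meromorphic g) (hD : Meromorphic D)
    (hDtop : ∀ z, meromorphicOrderAt D z ≠ ⊤) {ι : Type*} (s : Finset ι) {b : ι → ℂ}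
    (hb : InjOn b s) :
    ∃ C, ∀ r ≠ 0, ∑ i ∈ s, proximity (fun z => g z - b i)⁻¹ ⊤ r ≤
      proximity D⁻¹ ⊤ r + ∑ i ∈ s, proximity (fun z => D z / (g z - b i)) ⊤ r + C := by
  classical
  obtain ⟨C, hC⟩ := exists_sum_posLog_norm_inv_le s hb
  refine ⟨max C 0, fun r hr => ?_⟩
  have hgb (i : ι) := meromorphic_sub_const hg (b i)
  have hq (i : ι) : Meromorphic fun z => D z / (g z - b i) := hD.div (hgb i)
  have i1 (i : ι) : CircleIntegrable (fun z => log⁺ ‖(fun z => g z - b i)⁻¹ z‖) 0 r :=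
    MeromorphicOn.circleIntegrable_posLog_norm fun z _ => (hgb i).inv z
  have i2 : CircleIntegrable (fun z => log⁺ ‖D⁻¹ z‖) 0 r :=
    MeromorphicOn.circleIntegrable_posLog_norm fun z _ => hD.inv z
  have i3 (i : ι) : CircleIntegrable (fun z => log⁺ ‖D z / (g z - b i)‖) 0 r :=
    MeromorphicOn.circleIntegrable_posLog_norm fun z _ => hq i z
  have i3s : CircleIntegrable (fun z => ∑ i ∈ s, log⁺ ‖D z / (g z - b i)‖) 0 r :=
    CircleIntegrable.fun_sum _ fun i _ => i3 i
  have i23 : CircleIntegrable (fun z => log⁺ ‖D⁻¹ z‖ + ∑ i ∈ s, log⁺ ‖D z / (g z - b i)‖) 0 r :=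
    i2.add i3s
  have hne : ∀ᶠ z in codiscreteWithin (sphere (0 : ℂ) |r|), D z ≠ 0 :=
    MeromorphicOn.eventually_codiscreteWithin_apply_ne_zero (fun z _ => hD z) fun z _ => hDtop z
  -- The pointwise inequality requires D z ≠ 0; setting the integrand to zero on this discrete
  -- exceptional set leaves the mean unchanged.
  have e1 : (fun z => ∑ i ∈ s, log⁺ ‖(fun z => g z - b i)⁻¹ z‖)
      =ᶠ[codiscreteWithin (sphere (0 : ℂ) |r|)]
      fun z => if D z = 0 then 0 else ∑ i ∈ s, log⁺ ‖(fun z => g z - b i)⁻¹ z‖ := by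
    filter_upwards [hne] with z hz
    rw [if_neg hz]
  simp only [proximity_top]
  rw [← circleAverage_fun_sum fun i _ => i1 i, ← circleAverage_fun_sum fun i _ => i3 i,
    ← circleAverage_fun_add i2 i3s, circleAverage_congr_codiscreteWithin e1 hr,
    ← circleAverage_const (max C 0) 0 r, ← circleAverage_fun_add i23 (circleIntegrable_const _ _ _)]
  refine circleAverage_mono
    ((CircleIntegrable.fun_sum _ fun i _ => i1 i).congr_codiscreteWithin e1)
    (i23.add (circleIntegrable_const _ _ _)) fun z _ => ?_
  split_ifs with h
  · have := Finset.sum_nonneg fun (i : ι) (_ : i ∈ s) =>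
      posLog_nonneg (x := ‖D z / (g z - b i)‖)
    have := posLog_nonneg (x := ‖D⁻¹ z‖)
    have := le_max_right C 0
    positivity
  · have := hC (g z) (D z) h
    simp only [Pi.inv_apply, norm_inv]
    linarith [le_max_left C 0]

/-- D/(g-b) is the shift quotient of g-b minus 1, divided by (q-1)z+c. The divisor has modulus at
least 1 on large circles, and subtracting 1 costs log 2. -/
lemma exists_proximity_hahnDiff_div_le_shift {g : ℂ → ℂ} (hg : Meromorphic g) {q : ℂ}
    (hq1 : ‖q‖ < 1) (c b : ℂ) :
    ∃ r₀, ∀ r ≥ r₀, proximity (fun z => hahnDiff q c g z / (g z - b)) ⊤ r ≤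
      proximity (fun z => (g (q * z + c) - b) / (g z - b)) ⊤ r + log 2 := by
  refine ⟨(1 + ‖c‖) / (1 - ‖q‖), fun r hr => ?_⟩
  have hq0 : 0 < 1 - ‖q‖ := by linarith
  have hr0 : 0 < r := lt_of_lt_of_le (by positivity) hr
  rw [ge_iff_le, div_le_iff₀ hq0] at hr
  have hm := meromorphic_sub_const hg b
  have hshift : Meromorphic fun z => (g (q * z + c) - b) / (g z - b) :=
    (meromorphic_comp_affine hm q c).div hm
  have i1 : CircleIntegrable (fun z => log⁺ ‖(g (q * z + c) - b) / (g z - b)‖) 0 r :=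
    MeromorphicOn.circleIntegrable_posLog_norm fun z _ => hshift z
  rw [proximity_top, proximity_top, ← circleAverage_const (log 2) 0 r,
    ← circleAverage_fun_add i1 (circleIntegrable_const _ _ _)]
  refine circleAverage_mono (MeromorphicOn.circleIntegrable_posLog_norm
    fun z _ => ((meromorphic_hahnDiff hg q c).div hm) z)
    (i1.add (circleIntegrable_const _ _ _)) fun z hz => ?_
  have hz' : ‖z‖ = r := by simpa [abs_of_pos hr0] using hz
  by_cases h0 : g z - b = 0
  · simp [h0, log_nonneg one_le_two]
  have hlin : 1 ≤ ‖(q - 1) * z + c‖ := by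
    have h1 : ‖(q - 1) * z‖ ≤ ‖(q - 1) * z + c‖ + ‖c‖ := by
      have := norm_sub_le ((q - 1) * z + c) c
      rwa [add_sub_cancel_right] at this
    have h2 : 1 - ‖q‖ ≤ ‖q - 1‖ := by
      have := norm_sub_norm_le 1 q
      rwa [norm_one, norm_sub_rev] at this
    rw [norm_mul, hz'] at h1
    nlinarith
  have e : hahnDiff q c g z / (g z - b) =
      ((g (q * z + c) - b) / (g z - b) + -1) * ((q - 1) * z + c)⁻¹ := by
    simp only [hahnDiff]
    have : (q - 1) * z + c ≠ 0 := by
      intro h; rw [h, norm_zero] at hlin; linarith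
    field_simp
    ring
  rw [e, norm_mul]
  have p1 : log⁺ ‖((q - 1) * z + c)⁻¹‖ = 0 := by
    rw [posLog_eq_zero_iff, norm_inv, abs_of_nonneg (by positivity)]
    exact inv_le_one_of_one_le₀ hlin
  have p2 := posLog_norm_add_le ((g (q * z + c) - b) / (g z - b)) (-1)
  have p3 := posLog_mul (x := ‖(g (q * z + c) - b) / (g z - b) + -1‖)
    (y := ‖((q - 1) * z + c)⁻¹‖)
  rw [norm_neg, norm_one, posLog_one, add_zero] at p2
  linarith

/-- The first main theorem in the three forms used later, with an error independent of r. -/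
lemma characteristic_sub_const_le {g : ℂ → ℂ} (hg : Meromorphic g) (b : ℂ) :
    ∃ C, ∀ r, characteristic (fun z => g z - b) ⊤ r ≤ nevT g r + C ∧
      nevT g r ≤ characteristic (fun z => g z - b)⁻¹ ⊤ r + C ∧
      characteristic (fun z => g z - b)⁻¹ ⊤ r ≤ nevT g r + C := by
  have hm := meromorphic_sub_const hg b
  set A := log⁺ ‖b‖ + log 2 with hA
  set A' := max |log ‖g 0 - b‖| |log ‖meromorphicTrailingCoeffAt (fun z => g z - b) 0‖| with hA'
  have hA'0 : 0 ≤ A' := (abs_nonneg _).trans (le_max_left _ _)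
  refine ⟨A + A', fun r => ?_⟩
  have h1 := abs_characteristic_sub_characteristic_shift_le (a₀ := b) (r := r) hg
  have h2 := characteristic_sub_characteristic_inv_le (R := r) hm
  rw [abs_le] at h1 h2
  have h1a := h1.1
  have h1b := h1.2
  have h2a := h2.1
  have h2b := h2.2
  unfold nevT
  refine ⟨?_, ?_, ?_⟩ <;> linarith

/-- The analogue of the lemma on the logarithmic derivative for the Hahn difference operator. -/
theorem exists_proximity_hahnDiff_div_le {g : ℂ → ℂ} (hg : Meromorphic g)
    (hconst : ¬ IsConstMeromorphic g) {q : ℂ} (hq : q ≠ 0) (hq1 : ‖q‖ < 1) (c b : ℂ) :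
    ∃ A B r₀, 0 ≤ A ∧ ∀ r ≥ r₀, ∀ K ≥ 4,
      proximity (fun z => hahnDiff q c g z / (g z - b)) ⊤ r ≤
        A / log K * nevT g (K ^ 2 * r) + B := by
  have hq0 : 0 < ‖q‖ := norm_pos_iff.2 hq
  obtain ⟨r₁, hr₁⟩ := exists_proximity_hahnDiff_div_le_shift hg hq1 c b
  obtain ⟨C, hC⟩ := characteristic_sub_const_le hg b
  set A := 4 * log 2 + log ((1 + ‖c‖) / ‖q‖) + 48 with hA
  have hA0 : 0 ≤ A := by
    have h1 : 0 ≤ log ((1 + ‖c‖) / ‖q‖) := by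
      apply log_nonneg
      rw [le_div_iff₀ hq0]
      linarith [norm_nonneg c]
    have h2 : 0 ≤ log 2 := log_nonneg one_le_two
    positivity
  refine ⟨2 * A, A * |2 * C| + log 2, max r₁ (max (1 / ‖q‖) ‖c‖), by positivity,
    fun r hr K hK => ?_⟩
  have h1 := hr₁ r ((le_max_left _ _).trans hr)
  have hrq : 1 ≤ ‖q‖ * r := by
    have : 1 / ‖q‖ ≤ r := ((le_max_left _ _).trans (le_max_right _ _)).trans hr
    rw [div_le_iff₀ hq0] at this
    linarith
  have h2 := proximity_shift_quotient_le_characteristic (f := fun z => g z - b)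
    (meromorphic_sub_const hg b)
    (meromorphicOrderAt_sub_const_ne_top hg hconst b) (c := c) hq hq1.le hrq
    (((le_max_right _ _).trans (le_max_right _ _)).trans hr) hK
  have hK0 : 0 < K := by linarith
  have hlogK : 1 ≤ log K := by
    rw [le_log_iff_exp_le hK0]
    linarith [exp_one_lt_d9]
  have hAK : 0 ≤ A / log K := by positivity
  have hAK' : A / log K ≤ A := div_le_self hA0 hlogK
  have h3 := hC (K ^ 2 * r)
  have h4 : A / log K * (characteristic (fun z => g z - b) ⊤ (K ^ 2 * r) +
      characteristic (fun z => g z - b)⁻¹ ⊤ (K ^ 2 * r)) ≤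
      A / log K * (2 * nevT g (K ^ 2 * r)) + A * |2 * C| := by
    have e1 : A / log K * (2 * C) ≤ A * |2 * C| :=
      (mul_le_mul_of_nonneg_left (le_abs_self (2 * C)) hAK).trans
        (mul_le_mul_of_nonneg_right hAK' (abs_nonneg _))
    have e2 := mul_le_mul_of_nonneg_left (add_le_add h3.1 h3.2.2) hAK
    have e3 : A / log K * (nevT g (K ^ 2 * r) + C + (nevT g (K ^ 2 * r) + C)) =
      A / log K * (2 * nevT g (K ^ 2 * r)) + A / log K * (2 * C) := by ring
    linarith
  have h5 : 2 * A / log K * nevT g (K ^ 2 * r) = A / log K * (2 * nevT g (K ^ 2 * r)) := by ring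
  linarith

end HahnNevanlinna

/-! ### The first inequality, and growth outside an exceptional set. -/

namespace HahnNevanlinna

open MeasureTheory Set Real Metric ValueDistribution MeromorphicOn

lemma characteristic_inv_sub_const_eq (g : ℂ → ℂ) (b : ℂ) (r : ℝ) :
    characteristic (fun z => g z - b)⁻¹ ⊤ r =
      proximity (fun z => g z - b)⁻¹ ⊤ r + nevNAt g b r := by
  rw [characteristic, Pi.add_apply, logCounting_inv, nevNAt,
    logCounting_coe_eq_logCounting_sub_const_zero]
  rfl

lemma nevT_le_proximity_inv_add_nevNAt {g : ℂ → ℂ} (hg : Meromorphic g) (b : ℂ) :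
    ∃ C, ∀ r, nevT g r ≤ proximity (fun z => g z - b)⁻¹ ⊤ r + nevNAt g b r + C := by
  obtain ⟨C, hC⟩ := characteristic_sub_const_le hg b
  refine ⟨C, fun r => ?_⟩
  linarith [(hC r).2.1, characteristic_inv_sub_const_eq g b r]

lemma proximity_hahnDiff_le {g : ℂ → ℂ} (hg : Meromorphic g) (hconst : ¬ IsConstMeromorphic g)
    (q c : ℂ) {r : ℝ} (hr : r ≠ 0) :
    proximity (hahnDiff q c g) ⊤ r ≤
      proximity g ⊤ r + proximity (fun z => hahnDiff q c g z / g z) ⊤ r := by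
  have hD := meromorphic_hahnDiff hg q c
  have hne : ∀ᶠ z in codiscreteWithin (sphere (0 : ℂ) |r|), g z ≠ 0 :=
    MeromorphicOn.eventually_codiscreteWithin_apply_ne_zero (fun z _ => hg z) fun z _ =>
      meromorphicOrderAt_ne_top_of_not_const hg hconst z
  have e : hahnDiff q c g =ᶠ[codiscreteWithin (sphere (0 : ℂ) |r|)]
      g * fun z => hahnDiff q c g z / g z := by
    filter_upwards [hne] with z hz
    simp only [Pi.mul_apply]
    field_simp
  rw [proximity_congr_codiscreteWithin e hr]
  exact proximity_mul_top_le hg (hD.div hg) r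

/-- The lemma on the Hahn difference quotient for finitely many values at once. -/
lemma exists_sum_proximity_hahnDiff_div_le {g : ℂ → ℂ} (hg : Meromorphic g)
    (hconst : ¬ IsConstMeromorphic g) {q : ℂ} (hq : q ≠ 0) (hq1 : ‖q‖ < 1) (c : ℂ)
    {ι : Type*} (s : Finset ι) (b : ι → ℂ) :
    ∃ A B r₀, 0 ≤ A ∧ ∀ r ≥ r₀, ∀ K ≥ 4,
      ∑ i ∈ s, proximity (fun z => hahnDiff q c g z / (g z - b i)) ⊤ r ≤
        A / log K * nevT g (K ^ 2 * r) + B := by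
  choose A B r₀ hA h using fun i => exists_proximity_hahnDiff_div_le hg hconst hq hq1 c (b i)
  obtain ⟨R, hR⟩ := (eventually_all_finset s).2
    (fun i _ => eventually_ge_atTop (r₀ i)) |>.exists_forall_of_atTop
  refine ⟨∑ i ∈ s, A i, ∑ i ∈ s, B i, R, Finset.sum_nonneg fun i _ => hA i, fun r hr K hK => ?_⟩
  rw [Finset.sum_div, Finset.sum_mul, ← Finset.sum_add_distrib]
  exact Finset.sum_le_sum fun i hi => h i r (hR r hr i hi) K hK

/-- The first inequality of the main theorem, with a quantitative error term. -/
theorem exists_mul_nevT_le {g : ℂ → ℂ} (hg : Meromorphic g)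
    (hconst : ¬ IsConstMeromorphic g) {q : ℂ} (hq : q ≠ 0) (hq1 : ‖q‖ < 1) (c : ℂ)
    {l : ℕ} {a : Fin l → WithTop ℂ} (ha : Function.Injective a) :
    ∃ A B r₀, 0 ≤ A ∧ ∀ r ≥ r₀, ∀ K ≥ 4, ((l : ℝ) - 2) * nevT g r ≤
      (∑ i, nevNAt g (a i) r) - hahnRamification q c g r +
        A / log K * nevT g (K ^ 2 * r) + B := by
  classical
  set D := hahnDiff q c g with hDdef
  have hD : Meromorphic D := meromorphic_hahnDiff hg q c
  set s := Finset.univ.filter fun i => a i ≠ ⊤ with hs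
  set t := Finset.univ.filter fun i => ¬ a i ≠ ⊤ with ht
  set b : Fin l → ℂ := fun i => (a i).untopD 0 with hb
  have hab : ∀ i ∈ s, a i = b i := fun i hi => by
    obtain ⟨x, hx⟩ := WithTop.ne_top_iff_exists.1 (Finset.mem_filter.1 hi).2
    simp [hb, ← hx]
  have hbinj : InjOn b s := fun i hi j hj hij => by
    apply ha
    rw [hab i hi, hab j hj, hij]
  have htcard : t.card ≤ 1 := by
    refine Finset.card_le_one.2 fun i hi j hj => ha ?_
    rw [not_not.1 (Finset.mem_filter.1 hi).2, not_not.1 (Finset.mem_filter.1 hj).2]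
  obtain ⟨C₁, hC₁⟩ := exists_sum_proximity_inv_le hg hD
    (meromorphicOrderAt_hahnDiff_ne_top hg hconst hq hq1 c) s hbinj
  choose C₂ hC₂ using fun i => nevT_le_proximity_inv_add_nevNAt hg (b i)
  obtain ⟨A₁, B₁, r₁, hA₁, h₁⟩ := exists_sum_proximity_hahnDiff_div_le hg hconst hq hq1 c s b
  obtain ⟨A₂, B₂, r₂, hA₂, h₂⟩ := exists_proximity_hahnDiff_div_le hg hconst hq hq1 c 0
  simp only [sub_zero] at h₂
  set C₃ := max |log ‖D 0‖| |log ‖meromorphicTrailingCoeffAt D 0‖| with hC₃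
  refine ⟨A₁ + A₂, B₁ + B₂ + C₁ + C₃ + ∑ i ∈ s, C₂ i, max 1 (max r₁ r₂), by positivity,
    fun r hr K hK => ?_⟩
  have hr1 : 1 ≤ r := (le_max_left _ _).trans hr
  have hr0 : r ≠ 0 := by positivity
  have k1 := h₁ r (((le_max_left _ _).trans (le_max_right _ _)).trans hr) K hK
  have k2 := h₂ r (((le_max_right _ _).trans (le_max_right _ _)).trans hr) K hK
  have k3 := hC₁ r hr0
  have k4 := proximity_hahnDiff_le hg hconst q c hr0
  -- First main theorem for D: with `k4` it gives m(r, 1/D) ≤ m(r, g) + N(r, D) - N(r, 1/D) plus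
  -- errors.
  have k5 := (abs_le.1 (characteristic_sub_characteristic_inv_le (R := r) hD)).1
  have k6 : ∑ i ∈ s, nevT g r ≤ ∑ i ∈ s, proximity (fun z => g z - b i)⁻¹ ⊤ r +
      ∑ i ∈ s, nevNAt g (a i) r + ∑ i ∈ s, C₂ i := by
    rw [← Finset.sum_add_distrib, ← Finset.sum_add_distrib]
    refine Finset.sum_le_sum fun i hi => ?_
    rw [hab i hi]
    exact hC₂ i r
  have hp : 0 ≤ proximity g ⊤ r := proximity_nonneg r
  -- At most one target is ∞, and it costs a second m(r, g); without it m(r, g) ≥ 0 is simply added.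
  -- Then 2m(r, g) = 2T - 2N(r, g) explains both the l - 2 and the ramification term.
  have k7 : ∑ i ∈ t, nevT g r ≤ proximity g ⊤ r + ∑ i ∈ t, nevNAt g (a i) r := by
    have : ∑ i ∈ t, nevT g r = t.card * proximity g ⊤ r + ∑ i ∈ t, nevNAt g (a i) r := by
      rw [← nsmul_eq_mul, ← Finset.sum_const, ← Finset.sum_add_distrib]
      refine Finset.sum_congr rfl fun i hi => ?_
      rw [not_not.1 (Finset.mem_filter.1 hi).2]
      rfl
    have h' : (t.card : ℝ) * proximity g ⊤ r ≤ 1 * proximity g ⊤ r :=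
      mul_le_mul_of_nonneg_right (by exact_mod_cast htcard) hp
    linarith
  have k8 : ∑ i ∈ s, nevT g r + ∑ i ∈ t, nevT g r = l * nevT g r := by
    rw [Finset.sum_filter_add_sum_filter_not]
    simp
  have k9 : ∑ i ∈ s, nevNAt g (a i) r + ∑ i ∈ t, nevNAt g (a i) r = ∑ i, nevNAt g (a i) r :=
    Finset.sum_filter_add_sum_filter_not _ _ _
  have k10 : nevT g r = proximity g ⊤ r + nevN g r := rfl
  have k11 : characteristic D ⊤ r = proximity D ⊤ r + nevN D r := rfl
  have k12 : characteristic D⁻¹ ⊤ r = proximity D⁻¹ ⊤ r + nevN D⁻¹ r := rfl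
  have k13 : (A₁ + A₂) / log K * nevT g (K ^ 2 * r) =
      A₁ / log K * nevT g (K ^ 2 * r) + A₂ / log K * nevT g (K ^ 2 * r) := by ring
  rw [hahnRamification, ← hDdef]
  linarith

/-- The characteristic of a non-constant meromorphic function is unbounded. -/
theorem tendsto_nevT_atTop {g : ℂ → ℂ} (hg : Meromorphic g) (hconst : ¬ IsConstMeromorphic g) :
    Tendsto (nevT g) atTop atTop := by
  -- At a point of analyticity g attains the value g z; this single point already contributes log r
  -- - log ‖z‖ to a counting function that T bounds up to a constant.
  obtain ⟨z, hz⟩ := ((hg 0).eventually_analyticAt).exists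
  have hm := meromorphic_sub_const hg (g z)
  have hd : 1 ≤ valueDivisor g (g z) z := by
    have han : AnalyticAt ℂ (fun w => g w - g z) z := hz.sub analyticAt_const
    have h1 : 0 < meromorphicOrderAt (fun w => g w - g z) z := by
      rw [← tendsto_zero_iff_meromorphicOrderAt_pos (hm z)]
      have := han.continuousAt.tendsto
      rw [sub_self] at this
      exact this.mono_left nhdsWithin_le_nhds
    rw [meromorphicOrderAt_eq_divisor_univ hm
      (meromorphicOrderAt_sub_const_ne_top hg hconst _ _)] at h1
    have h2 : 0 < divisor (fun w => g w - g z) univ z := by exact_mod_cast h1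
    simp only [valueDivisor, Function.locallyFinsuppWithin.posPart_apply]
    rw [posPart_def]
    omega
  obtain ⟨C, hC⟩ := characteristic_sub_const_le hg (g z)
  refine tendsto_atTop_mono' (f₁ := fun r => log r - log ‖z‖ - C) _ ?_ ?_
  · filter_upwards [eventually_ge_atTop 1, eventually_ge_atTop ‖z‖] with r hr hrz
    have h1 := sum_le_logCounting (D := valueDivisor g (g z))
      (valueDivisor_nonneg g (g z)) hr (s := {z}) (by simpa using hrz)
    rw [Finset.sum_singleton, ← nevNAt_eq_logCounting_valueDivisor] at h1
    have h2 : log ‖z‖ ≤ log r := by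
      rcases eq_or_ne ‖z‖ 0 with h0 | h0
      · rw [h0, log_zero]; exact log_nonneg hr
      · exact log_le_log (by positivity) hrz
    have h3 : (1 : ℝ) ≤ valueDivisor g (g z) z := by exact_mod_cast hd
    have h4 : nevNAt g (g z) r ≤ characteristic (fun w => g w - g z)⁻¹ ⊤ r := by
      have hp : 0 ≤ proximity (fun w => g w - g z)⁻¹ ⊤ r := proximity_nonneg r
      linarith [characteristic_inv_sub_const_eq g (g z) r]
    have h5 := (hC r).2.2
    have h6 : log r - log ‖z‖ ≤ valueDivisor g (g z) z * (log r - log ‖z‖) :=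
      le_mul_of_one_le_left (by linarith) h3
    linarith
  · exact tendsto_atTop_add_const_right _ _
      (tendsto_atTop_add_const_right _ _ tendsto_log_atTop)

/-- Off an exceptional set of zero logarithmic density, the characteristic of a function of order
zero does not double between `r` and `K ^ 2 * r`, whatever `K` is. -/
theorem exists_logDensityOne_nevT_le {g : ℂ → ℂ} (hg : Meromorphic g)
    (hT : Tendsto (nevT g) atTop atTop) (horder : growthOrder g = 0) :
    ∃ E, HasLogDensityOne E ∧ ∀ n : ℕ, ∀ᶠ r in atTop ⊓ 𝓟 E,
      nevT g (((n : ℝ) + 4) ^ 2 * r) ≤ 2 * nevT g r := by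
  -- The cut-off at radius 1 makes v monotone on the whole line, since T is known to be nonnegative
  -- only for r ≥ 1.
  set v : ℝ → ℝ := fun t => log⁺ (nevT g (max 1 t)) with hv
  have hvm : Monotone v := fun x y hxy => by
    have h1 : nevT g (max 1 x) ≤ nevT g (max 1 y) :=
      characteristic_monotoneOn hg (mem_Ioi.2 (by positivity)) (mem_Ioi.2 (by positivity))
        (max_le_max_left 1 hxy)
    exact posLog_le_posLog (characteristic_nonneg (le_max_left _ _)) h1
  have hvlim : Tendsto (fun r => v r / log r) atTop (𝓝 0) := by
    rw [tendsto_order]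
    refine ⟨fun a ha => ?_, fun a ha => ?_⟩
    · filter_upwards [eventually_ge_atTop 1] with r hr
      exact ha.trans_le (div_nonneg posLog_nonneg (log_nonneg hr))
    · have h1 : limsup (fun r : ℝ => ((log⁺ (nevT g r) / log r : ℝ) : EReal)) atTop
          < (a : EReal) := by
        have : growthOrder g < (a : EReal) := by rw [horder]; exact_mod_cast ha
        exact this
      filter_upwards [eventually_lt_of_limsup_lt h1, eventually_ge_atTop 1] with r hr hr1
      simp only [hv, max_eq_right hr1]
      exact_mod_cast hr
  -- An increase of log T by less than log 2 means that T less than doubles.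
  obtain ⟨E, hE, hEn⟩ := exists_logDensityOne_eventually_notMem
    (B := fun n : ℕ => {t | v t + log 2 ≤ v (((n : ℝ) + 4) ^ 2 * t)}) fun n =>
      hasLogDensityZero_of_monotone hvm (fun _ => posLog_nonneg) hvlim
        (by nlinarith [n.cast_nonneg (α := ℝ)]) (log_pos one_lt_two)
  refine ⟨E, hE, fun n => ?_⟩
  filter_upwards [hEn n, (eventually_ge_atTop (1 : ℝ)).filter_mono inf_le_left,
    (hT.eventually_ge_atTop 1).filter_mono inf_le_left] with r hr hr1 hrT
  replace hr := not_le.1 hr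
  simp only [hv] at hr
  have hM : (1 : ℝ) ≤ ((n : ℝ) + 4) ^ 2 := by nlinarith [n.cast_nonneg (α := ℝ)]
  have hMr : 1 ≤ ((n : ℝ) + 4) ^ 2 * r := one_le_mul_of_one_le_of_one_le hM hr1
  rw [max_eq_right hr1, max_eq_right hMr] at hr
  have hTM : nevT g r ≤ nevT g (((n : ℝ) + 4) ^ 2 * r) :=
    characteristic_monotoneOn hg (mem_Ioi.2 (by linarith)) (mem_Ioi.2 (by linarith))
      (le_mul_of_one_le_left (by linarith) hM)
  rw [posLog_eq_log (by rw [abs_of_nonneg] <;> linarith),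
    posLog_eq_log (by rw [abs_of_nonneg] <;> linarith),
    ← log_mul (by linarith) two_ne_zero, log_lt_log_iff (by linarith) (by linarith)] at hr
  linarith

end HahnNevanlinna

/-! ### Assembly: letting K grow along E. -/

theorem mainTheorem1 (g : ℂ → ℂ) (hg : Meromorphic g)
    (hconst : ¬ HahnNevanlinna.IsConstMeromorphic g)
    (horder : HahnNevanlinna.growthOrder g = 0)
    (q c : ℂ) (hq0 : 0 < ‖q‖) (hq1 : ‖q‖ < 1)
    (l : ℕ) (hl : 2 ≤ l) (a : Fin l → WithTop ℂ) (ha : Function.Injective a) :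
    ∃ E : Set ℝ, HahnNevanlinna.HasLogDensityOne E ∧
      ∃ S₁ S₂ : ℝ → ℝ,
        S₁ =o[atTop ⊓ 𝓟 E] HahnNevanlinna.nevT g ∧
        S₂ =o[atTop ⊓ 𝓟 E] HahnNevanlinna.nevT g ∧
        ∀ r ∈ E,
          ((l : ℝ) - 2) * HahnNevanlinna.nevT g r ≤
            (∑ i, HahnNevanlinna.nevNAt g (a i) r) - HahnNevanlinna.hahnRamification q c g r + S₁ r ∧
          (∑ i, HahnNevanlinna.nevNAt g (a i) r) - HahnNevanlinna.hahnRamification q c g r + S₁ r ≤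
            (∑ i, HahnNevanlinna.hahnN q c g (a i) r) + S₂ r := by
  have hq : q ≠ 0 := norm_pos_iff.1 hq0
  have hT := HahnNevanlinna.tendsto_nevT_atTop hg hconst
  obtain ⟨E, hE, hdouble⟩ := HahnNevanlinna.exists_logDensityOne_nevT_le hg hT horder
  obtain ⟨A, B, r₀, hA, hfirst⟩ := HahnNevanlinna.exists_mul_nevT_le hg hconst hq hq1 c ha
  obtain ⟨C, r₁, hsecond⟩ :=
    HahnNevanlinna.exists_sum_nevNAt_sub_hahnRamification_le hg hconst hq hq1 c ha
  set T := HahnNevanlinna.nevT g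
  set N : ℝ → ℝ := fun r => ∑ i, HahnNevanlinna.nevNAt g (a i) r
  set R := HahnNevanlinna.hahnRamification q c g
  set H : ℝ → ℝ := fun r => ∑ i, HahnNevanlinna.hahnN q c g (a i) r
  -- The errors are defined as the exact excesses, so both inequalities hold for every r in E; the
  -- estimates are needed only to show that they are o(T).
  set S₁ : ℝ → ℝ := fun r => max 0 (((l : ℝ) - 2) * T r - (N r - R r)) with hS₁
  set S₂ : ℝ → ℝ := fun r => max 0 (N r - R r + S₁ r - H r) with hS₂
  have hconst_o (x : ℝ) : (fun _ => x) =o[atTop ⊓ 𝓟 E] T :=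
    (isLittleO_const_left.2 (Or.inr (tendsto_norm_atTop_atTop.comp hT))).mono inf_le_left
  have hT0 : ∀ᶠ r in atTop ⊓ 𝓟 E, 0 ≤ T r :=
    (hT.eventually_ge_atTop 0).filter_mono inf_le_left
  have hS₁o : S₁ =o[atTop ⊓ 𝓟 E] T := by
    rw [isLittleO_iff]
    intro ε hε
    have hlim : Tendsto (fun n : ℕ => A / Real.log ((n : ℝ) + 4)) atTop (𝓝 0) :=
      tendsto_const_nhds.div_atTop (Real.tendsto_log_atTop.comp
        (tendsto_atTop_add_const_right _ _ tendsto_natCast_atTop_atTop))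
    -- K = n + 4 is chosen after ε: doubling turns A / log K < ε/4 into an error of at most (ε/2) T,
    -- and the constant B takes the other half.
    obtain ⟨n, hn⟩ := (hlim.eventually (gt_mem_nhds (show (0 : ℝ) < ε / 4 by positivity))).exists
    have hB := (isLittleO_iff.1 (hconst_o B)) (show (0 : ℝ) < ε / 2 by positivity)
    filter_upwards [hB, hT0, hdouble n,
      (eventually_ge_atTop r₀).filter_mono inf_le_left] with r hBr hTr hdr hr
    have hK : (4 : ℝ) ≤ (n : ℝ) + 4 := by linarith [n.cast_nonneg (α := ℝ)]
    have h1 := hfirst r hr _ hK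
    have hlog : 0 ≤ A / Real.log ((n : ℝ) + 4) :=
      div_nonneg hA (Real.log_nonneg (by linarith))
    have h2 := (mul_le_mul_of_nonneg_left hdr hlog).trans
      (mul_le_mul_of_nonneg_right hn.le (by positivity : 0 ≤ 2 * T r))
    rw [Real.norm_eq_abs, Real.norm_eq_abs, abs_of_nonneg hTr] at hBr ⊢
    rw [abs_of_nonneg (le_max_left _ _)]
    have h3 := le_abs_self B
    refine max_le (by positivity) ?_
    simp only [N]
    linarith
  refine ⟨E, hE, S₁, S₂, hS₁o, ?_, fun r _ => ⟨?_, ?_⟩⟩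
  · refine IsBigO.trans_isLittleO (g := fun r => ‖S₁ r‖ + ‖|C|‖) ?_
      (hS₁o.norm_left.add (hconst_o |C|).norm_left)
    refine IsBigO.of_bound 1 ?_
    filter_upwards [(eventually_ge_atTop r₁).filter_mono inf_le_left] with r hr
    have h1 := hsecond r hr
    have h0 : 0 ≤ S₁ r := le_max_left _ _
    rw [one_mul, Real.norm_eq_abs, Real.norm_eq_abs, Real.norm_eq_abs, Real.norm_eq_abs, abs_abs,
      abs_of_nonneg h0, abs_of_nonneg (le_max_left _ _), abs_of_nonneg (by positivity)]
    refine max_le (by positivity) ?_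
    have := le_abs_self C
    simp only [N, H, R] at *
    linarith
  · have := le_max_right 0 (((l : ℝ) - 2) * T r - (N r - R r))
    simp only [hS₁]
    linarith
  · have := le_max_right 0 (N r - R r + S₁ r - H r)
    simp only [hS₂]
    linarith
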